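/- Let $X$ be a path-connected metrizable ANR (absolute neighbourhood retract) whose fundamental group $\pi_1(X)$ is torsion-free. Let $S_1X$ be the space of nullhomotopic continuous maps $S^1\to X$ and $B_2X$ the space of continuous maps $B^2\to X$ from the closed unit disc, both with the compact-open topology; let $r:B_2X\to S_1X$, $r(u)=u|_{S^1}$, let $c_1(X)\subset S_1X$ be the set of constant maps, and let $O(2)$ act on $S_1X$ by $(M\cdot\gamma)(p)=\gamma(M^{-1}p)$. For $B\subset S_1X$ let $\mathsf{SC}_{1,X}(B)\in\mathbb{N}_0\cup\{+\infty\}$ be the least $k$ such that $B$ is a union of $k$ relatively open subsets over each of which $r$ has a continuous section (so $\mathsf{SC}_{1,X}(\varnothing)=0$). Let $G\subset O(2)$ be a closed subgroup, let $A\subset S_1X$ be $G$-invariant with $c_1(X)\subset A$, let $F:A\to\mathbb{R}$ be continuous and bounded from below, and let $\varphi:A\to A$ be a homotopy equivalence. Assume that $(G,A,F,\varphi)$ is admissible, i.e. (i) $F$ is $G$-invariant and the fixed point set $\mathrm{Fix}\,\varphi$ is a $G$-invariant set; (ii) $F$ is constant on $c_1(X)$; (iii) $(F,\varphi)$ satisfies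 condition (D): $F(\varphi(x))<F(x)$ for all $x\in A\setminus\mathrm{Fix}\,\varphi$, and if $F$ is bounded on $B\subset A$ but $\{F(y)-F(\varphi(y)) : y\in B\}$ is not bounded away from zero, then $\overline{B}\cap\mathrm{Fix}\,\varphi\neq\varnothing$ (closure in $A$); (iv) every point of $F(\mathrm{Fix}\,\varphi)$ is isolated in $F(\mathrm{Fix}\,\varphi)$. For $\lambda\in\mathbb{R}$ put $F^\lambda=\{\gamma\in A : F(\gamma)\le\lambda\}$. Let $\nu(\varphi,F,\lambda)$ and $\nu(\varphi)$ in $\mathbb{N}_0\cup\{+\infty\}$ be the numbers of $G$-orbits of non-constant elements of $\mathrm{Fix}\,\varphi\cap F^\lambda$ and of $\mathrm{Fix}\,\varphi$, respectively. Then: a) If $\mathsf{SC}_{1,X}(\varphi(B))\ge\mathsf{SC}_{1,X}(B)$ for every closed subset $B$ of $A$, then $\nu(\varphi,F,\lambda)\ge\mathsf{SC}_{1,X}(F^\lambda)-1$ for every $\lambda\in\mathbb{R}$. b) If $\varphi$ is homotopic to $\mathrm{id}_A$ and $F(\mathrm{Fix}\,\varphi)$ is finite, then $\nu(\varphi)\ge\mathsf{SC}_{1,X}(A)-1$.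 -/

import Mathlib

universe u

/-- The Euclidean space `ℝ^(n+1)`. -/
abbrev Euc (n : ℕ) : Type := EuclideanSpace ℝ (Fin (n + 1))

/-- The unit sphere `S^n` in `ℝ^(n+1)`. -/
abbrev USphere (n : ℕ) : Type := Metric.sphere (0 : Euc n) 1

/-- The closed unit ball `B^(n+1)` in `ℝ^(n+1)`. -/
abbrev UBall (n : ℕ) : Type := Metric.closedBall (0 : Euc n) 1

/-- The orthogonal group `O(n+1)`, topologized as a subspace of the space of matrices. -/
abbrev OrthGroup (n : ℕ) : Type := Matrix.orthogonalGroup (Fin (n + 1)) ℝ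

/-- `X` is a metrizable absolute neighbourhood retract: every continuous map into `X` from a
closed subset of a metrizable space extends to an open neighbourhood of that subset. -/
def IsMetrizableANR (X : Type u) [TopologicalSpace X] : Prop :=
  TopologicalSpace.MetrizableSpace X ∧
    ∀ (Y : Type u) [TopologicalSpace Y] [TopologicalSpace.MetrizableSpace Y] (C : Set Y),
      IsClosed C → ∀ f : C(C, X), ∃ (U : Set Y) (hCU : C ⊆ U) (g : C(U, X)), IsOpen U ∧
        ∀ c : C, g (Set.inclusion hCU c) = f c

/-- All fundamental groups of `X` are torsion-free: the identity is the only element of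
finite order. -/
def HasTorsionFreePi1 (X : Type*) [TopologicalSpace X] : Prop :=
  ∀ (x : X) (g : FundamentalGroup X x), IsOfFinOrder g → g = 1

/-- The sectional category of `p : E → B`: the least `k` such that `B` is covered by `k` open
sets over each of which `p` has a continuous local section (`⊤` if there is no such `k`).
It is `0` exactly if `B` is empty. -/
noncomputable def secat {E B : Type*} [TopologicalSpace E] [TopologicalSpace B] (p : E → B) :
    ℕ∞ :=
  sInf {k : ℕ∞ | ∃ m : ℕ, k = m ∧ ∃ U : Fin m → Set B, (⋃ i, U i) = Set.univ ∧
    ∀ i, IsOpen (U i) ∧ ∃ s : C(U i, E), ∀ b : U i, p (s b) = b}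

section Spheres

variable (n : ℕ) (X : Type*) [TopologicalSpace X]

/-- `S_n X`: the nullhomotopic continuous maps `S^n → X`, with the compact-open topology. -/
abbrev SphereMaps : Type _ := {γ : C(USphere n, X) // γ.Nullhomotopic}

/-- `B_{n+1} X`: the continuous maps `B^(n+1) → X`, with the compact-open topology. -/
abbrev BallMaps : Type _ := C(UBall n, X)

/-- The inclusion of `S^n` into `B^(n+1)`. -/
def sphereIncl : C(USphere n, UBall n) where
  toFun := Set.inclusion Metric.sphere_subset_closedBall
  continuous_toFun := continuous_inclusion _

variable {n X} in
theorem nullhomotopic_restrict (u : BallMaps n X) :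
    (u.comp (sphereIncl n)).Nullhomotopic := by
  have : ContractibleSpace (UBall n) :=
    (convex_closedBall (0 : Euc n) 1).contractibleSpace ⟨0, by simp⟩
  exact ((id_nullhomotopic (UBall n)).comp_right u).comp_left (sphereIncl n)

/-- The restriction map `r_n : B_{n+1} X → S_n X`. -/
def restrictToSphere (u : BallMaps n X) : SphereMaps n X :=
  ⟨u.comp (sphereIncl n), nullhomotopic_restrict u⟩

/-- The set `c_n(X)` of constant maps in `S_n X`. -/
def constMaps : Set (SphereMaps n X) := {γ | ∃ x : X, ∀ p, γ.1 p = x}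

/-- The relative spherical complexity `SC_{n,X}(A)` of `A ⊆ S_n X`: the sectional category of
the restriction `r_n⁻¹(A) → A` of `r_n`. -/
noncomputable def SC (A : Set (SphereMaps n X)) : ℕ∞ :=
  secat (A.restrictPreimage (restrictToSphere n X))

end Spheres

section Action

variable {n : ℕ} {X : Type*} [TopologicalSpace X]

theorem norm_orth_mulVec (M : OrthGroup n) (v : Euc n) :
    ‖(WithLp.toLp 2 (M.1.mulVec v.ofLp) : Euc n)‖ = ‖v‖ := by
  have h : M.1.transpose * M.1 = 1 := by
    exact (Matrix.mem_orthogonalGroup_iff' (Fin (n + 1)) ℝ).1 M.2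
  have h2 : (M.1.mulVec v.ofLp) ⬝ᵥ (M.1.mulVec v.ofLp) = v.ofLp ⬝ᵥ v.ofLp := by
    rw [Matrix.dotProduct_mulVec, Matrix.vecMul_mulVec, h, Matrix.vecMul_one]
  rw [EuclideanSpace.norm_eq, EuclideanSpace.norm_eq]
  congr 1
  simpa [dotProduct, sq] using h2

/-- The action of an orthogonal matrix on `S^n` by matrix multiplication. -/
def orthOnSphere (M : OrthGroup n) : C(USphere n, USphere n) where
  toFun p := ⟨WithLp.toLp 2 (M.1.mulVec p.1.ofLp), by
    rw [mem_sphere_zero_iff_norm, norm_orth_mulVec]; exact mem_sphere_zero_iff_norm.1 p.2⟩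
  continuous_toFun := by
    refine Continuous.subtype_mk ?_ _
    refine (PiLp.continuous_toLp 2 _).comp ?_
    exact Continuous.matrix_mulVec continuous_const
      ((PiLp.continuous_ofLp 2 _).comp continuous_subtype_val)

/-- The left action of `O(n+1)` on `S_n X` given by `(M • γ)(p) = γ(M⁻¹ p)`. -/
instance sphereMapsAction : MulAction (OrthGroup n) (SphereMaps n X) where
  smul M γ := ⟨γ.1.comp (orthOnSphere M⁻¹), γ.2.comp_left _⟩
  one_smul γ := by
    apply Subtype.ext
    ext p
    change γ.1 (orthOnSphere (1 : OrthGroup n)⁻¹ p) = γ.1 p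
    congr 1
    apply Subtype.ext
    simp [orthOnSphere]
  mul_smul M N γ := by
    apply Subtype.ext
    ext p
    change γ.1 (orthOnSphere (M * N)⁻¹ p) = γ.1 (orthOnSphere N⁻¹ (orthOnSphere M⁻¹ p))
    congr 1
    apply Subtype.ext
    rw [mul_inv_rev]
    simp [orthOnSphere]

/-- `A ⊆ S_n X` is invariant under the action of `G`. -/
def IsInvariantSet (G : Subgroup (OrthGroup n)) (A : Set (SphereMaps n X)) : Prop :=
  ∀ g ∈ G, ∀ γ ∈ A, g • γ ∈ A

/-- The continuous map `f : Y → Z` is a homotopy equivalence. -/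
def IsHomotopyEquiv {Y Z : Type*} [TopologicalSpace Y] [TopologicalSpace Z] (f : C(Y, Z)) :
    Prop :=
  ∃ e : ContinuousMap.HomotopyEquiv Y Z, e.toFun = f

/-- Condition (D) for the function `F` and the self-map `φ` of the space `Y`. -/
structure ConditionD {Y : Type*} [TopologicalSpace Y] (F : C(Y, ℝ)) (φ : C(Y, Y)) : Prop where
  decreasing : ∀ y, φ y ≠ y → F (φ y) < F y
  closure_inter_fix : ∀ B : Set Y, (∃ K : ℝ, ∀ y ∈ B, |F y| ≤ K) →
    (∀ ε > 0, ∃ y ∈ B, |F y - F (φ y)| < ε) →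
    (closure B ∩ Function.fixedPoints φ).Nonempty

/-- Admissibility of the quadruple `(G, A, F, φ)`. -/
structure Admissible (G : Subgroup (OrthGroup n)) (A : Set (SphereMaps n X))
    (F : C(A, ℝ)) (φ : C(A, A)) : Prop where
  invariant_fun : ∀ g ∈ G, ∀ γ δ : A, δ.1 = g • γ.1 → F δ = F γ
  invariant_fix : IsInvariantSet G (Subtype.val '' Function.fixedPoints φ)
  const_on_constMaps : ∀ γ δ : A, γ.1 ∈ constMaps n X → δ.1 ∈ constMaps n X → F γ = F δ
  conditionD : ConditionD F φ
  isolated_values : ∀ a ∈ F '' Function.fixedPoints φ,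
    ∃ ε > 0, ∀ b ∈ F '' Function.fixedPoints φ, |b - a| < ε → b = a

/-- The number (possibly infinite) of `G`-orbits of non-constant elements of `S ⊆ S_n X`. -/
noncomputable def numNonconstOrbits (G : Subgroup (OrthGroup n)) (S : Set (SphereMaps n X)) :
    ℕ∞ :=
  {O : Set (SphereMaps n X) | ∃ γ ∈ S, γ ∉ constMaps n X ∧ O = MulAction.orbit G γ}.encard

/-- The sublevel set `F^lam = {γ ∈ A | F γ ≤ lam}`, as a subset of `S_n X`. -/
def sublevel {A : Set (SphereMaps n X)} (F : C(A, ℝ)) (lam : ℝ) : Set (SphereMaps n X) :=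
  Subtype.val '' {γ : A | F γ ≤ lam}

/-- The fixed point set of `φ : A → A`, as a subset of `S_n X`. -/
def fixSet {A : Set (SphereMaps n X)} (φ : C(A, A)) : Set (SphereMaps n X) :=
  Subtype.val '' Function.fixedPoints φ

/-- `φ` does not decrease the spherical complexity of closed subsets of `A`. -/
def ComplexityMonotone {A : Set (SphereMaps n X)} (φ : C(A, A)) : Prop :=
  ∀ B : Set A, IsClosed B → SC n X (Subtype.val '' B) ≤ SC n X (Subtype.val '' (φ '' B))

end Action

/-! The argument is of Lusternik–Schnirelmann type, with fixed points of `φ` as critical points and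
sections of the restriction map in place of contractible sets. Condition (D) makes `φ` lower `F` by
a uniform amount on a closed slab `a ≤ F ≤ b` away from a neighbourhood of its fixed points. If `φ`
does not decrease complexity, `SC` of sublevel sets is therefore constant across intervals without
critical values. If a single open set `W`, with a section over `W ∩ A`, contains all fixed points in
question, `SC` grows by at most one at each critical value (`SC_sublevel_le_add_one`,
`SC_sublevel_le_encard`). Torsion-freeness produces `W`. A non-constant loop with rotational
symmetry of order `m` factors as `g(z ^ m)`. The `m`-th power of the class of `g` is trivial, so `g`
bounds a disc `u`, and `p ↦ u((w p) ^ m)` fills the rotated loops consistently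
(`fillable_rotOrbit`). A `G`-orbit lies in two rotation orbits; finitely many of these and the
constant loops form a closed set with a section, which the ANR property extends to a neighbourhood
(`Fillable.exists_isOpen`). Since `F` is constant on orbits and on constant loops, there are at most
`ν + 1` critical values, which gives a). For b), a homotopy from the identity to `φ` makes `φ`
complexity monotone, and its iterates, run for a time depending continuously on the point, deform
`A` into a sublevel set above all critical values. -/

open Set Topology

/-- Over `B ⊆ S_n X` the restriction map `r_n` has a continuous section. -/
def Fillable {n : ℕ} {X : Type*} [TopologicalSpace X] (B : Set (SphereMaps n X)) : Prop :=
  ∃ s : C(B, BallMaps n X), ∀ b : B, restrictToSphere n X (s b) = b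

/-! ### Sections over subsets and elementary properties of `SC` -/

section Fillable

variable {n : ℕ} {X : Type*} [TopologicalSpace X]

theorem restrictToSphere_eq_iff (u : BallMaps n X) (γ : SphereMaps n X) :
    restrictToSphere n X u = γ ↔ ∀ p, u (sphereIncl n p) = γ.1 p := by
  rw [Subtype.ext_iff, ContinuousMap.ext_iff]
  rfl

/-- A section of `r_n` over `B` is the same as a jointly continuous extension to the ball. -/
theorem fillable_iff_uncurry {B : Set (SphereMaps n X)} :
    Fillable B ↔ ∃ H : B × UBall n → X, Continuous H ∧
      ∀ (b : B) (p : USphere n), H (b, sphereIncl n p) = b.1.1 p := by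
  constructor
  · rintro ⟨s, hs⟩
    exact ⟨_, ContinuousMap.continuous_uncurry_of_continuous s, fun b p =>
      (restrictToSphere_eq_iff _ _).1 (hs b) p⟩
  · rintro ⟨H, hH, h⟩
    exact ⟨ContinuousMap.curry ⟨H, hH⟩, fun b => (restrictToSphere_eq_iff _ _).2 (h b)⟩

theorem Fillable.mono {B C : Set (SphereMaps n X)} (h : Fillable C) (hBC : B ⊆ C) :
    Fillable B := by
  obtain ⟨s, hs⟩ := h
  exact ⟨s.comp ⟨Set.inclusion hBC, continuous_inclusion hBC⟩, fun b => hs _⟩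

theorem fillable_empty : Fillable (∅ : Set (SphereMaps n X)) :=
  ⟨⟨fun b => b.2.elim, continuous_of_const fun b => b.2.elim⟩, fun b => b.2.elim⟩

/-- Taking the open sets in the whole loop space lets covers of different subsets be compared
directly. -/
theorem SC_le_iff {B : Set (SphereMaps n X)} {m : ℕ} :
    SC n X B ≤ m ↔ ∃ U : Fin m → Set (SphereMaps n X), B ⊆ ⋃ i, U i ∧
      ∀ i, IsOpen (U i) ∧ Fillable (U i ∩ B) := by
  constructor
  · intro h
    have hne : {k : ℕ∞ | ∃ m : ℕ, k = m ∧ ∃ U : Fin m → Set B, (⋃ i, U i) = Set.univ ∧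
        ∀ i, IsOpen (U i) ∧ ∃ s : C(U i, restrictToSphere n X ⁻¹' B),
          ∀ b : U i, B.restrictPreimage (restrictToSphere n X) (s b) = b}.Nonempty := by
      by_contra hne
      rw [SC, secat, not_nonempty_iff_eq_empty.1 hne, sInf_empty] at h
      simp at h
    obtain ⟨k, hk, V, hV, hVs⟩ := csInf_mem hne
    have hkm : k ≤ m := by
      have : (k : ℕ∞) ≤ m := hk ▸ h
      exact_mod_cast this
    choose hVo s hs using hVs
    choose W hWo hW using fun i => isOpen_induced_iff.1 (hVo i)
    -- A cover by fewer than `m` sets is padded with empty sets.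
    refine ⟨fun i => if hi : i.1 < k then W ⟨i, hi⟩ else ∅, ?_, fun i => ?_⟩
    · intro b hb
      have : (⟨b, hb⟩ : B) ∈ ⋃ i, V i := hV ▸ mem_univ _
      obtain ⟨i, hi⟩ := mem_iUnion.1 this
      refine mem_iUnion.2 ⟨⟨i, i.2.trans_le hkm⟩, ?_⟩
      rw [← hW i] at hi
      simpa using hi
    · by_cases hi : i.1 < k
      · simp only [hi, dif_pos]
        refine ⟨hWo _, ?_⟩
        let j : Fin k := ⟨i, hi⟩
        have hj : ∀ b : ↥(W j ∩ B), (⟨b.1, b.2.2⟩ : B) ∈ V j := fun b => by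
          rw [← hW j]; exact b.2.1
        refine ⟨⟨fun b => (s j ⟨⟨b.1, b.2.2⟩, hj b⟩).1, by fun_prop⟩, fun b => ?_⟩
        exact congrArg Subtype.val (hs j ⟨⟨b.1, b.2.2⟩, hj b⟩)
      · simp only [hi, dif_neg, not_false_eq_true, empty_inter]
        exact ⟨isOpen_empty, fillable_empty⟩
  · rintro ⟨U, hU, hUs⟩
    refine sInf_le ⟨m, rfl, fun i => Subtype.val ⁻¹' U i, ?_, fun i =>
      ⟨(hUs i).1.preimage continuous_subtype_val, ?_⟩⟩
    · rw [eq_univ_iff_forall]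
      rintro ⟨b, hb⟩
      simpa using hU hb
    · obtain ⟨s, hs⟩ := (hUs i).2
      have hs' : ∀ b : ↥(Subtype.val ⁻¹' U i : Set B),
          s ⟨b.1.1, b.2, b.1.2⟩ ∈ restrictToSphere n X ⁻¹' B := fun b => by
        rw [mem_preimage, hs]; exact b.1.2
      refine ⟨⟨fun b => ⟨s ⟨b.1.1, b.2, b.1.2⟩, hs' b⟩, by fun_prop⟩, fun b => ?_⟩
      exact Subtype.ext (hs _)

theorem SC_le_of_forall {B C : Set (SphereMaps n X)}
    (h : ∀ m : ℕ, SC n X C ≤ m → SC n X B ≤ m) : SC n X B ≤ SC n X C := by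
  cases hC : SC n X C with
  | top => exact le_top
  | coe m => exact h m hC.le

theorem SC_mono {B C : Set (SphereMaps n X)} (hBC : B ⊆ C) : SC n X B ≤ SC n X C := by
  refine SC_le_of_forall fun m h => ?_
  obtain ⟨U, hU, hUs⟩ := SC_le_iff.1 h
  exact SC_le_iff.2 ⟨U, hBC.trans hU, fun i =>
    ⟨(hUs i).1, (hUs i).2.mono (inter_subset_inter_right _ hBC)⟩⟩

theorem SC_empty : SC n X (∅ : Set (SphereMaps n X)) = 0 :=
  nonpos_iff_eq_zero.1 <| (SC_le_iff (m := 0)).2 ⟨fun _ => ∅, by simp, fun i => i.elim0⟩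

end Fillable

/-! ### Homotopy monotonicity of `SC` -/

section Homotopy

variable {n : ℕ} {X : Type*} [TopologicalSpace X]

/-- Twice a point of the ball, pushed back radially into the ball. -/
noncomputable def doubleInBall (n : ℕ) : C(UBall n, UBall n) where
  toFun p := ⟨(max 1 ‖(2 : ℝ) • p.1‖)⁻¹ • ((2 : ℝ) • p.1), by
    have h : (0 : ℝ) < max 1 ‖(2 : ℝ) • p.1‖ := lt_max_of_lt_left one_pos
    rw [mem_closedBall_zero_iff, norm_smul, norm_inv, Real.norm_of_nonneg h.le,
      inv_mul_le_iff₀ h, mul_one]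
    exact le_max_right _ _⟩
  continuous_toFun := by
    have h : Continuous fun p : UBall n => (2 : ℝ) • p.1 := by fun_prop
    exact Continuous.subtype_mk (((continuous_const.max h.norm).inv₀ fun p =>
      (lt_max_of_lt_left one_pos).ne').smul h) _

/-- The radial projection of the ball without the origin to the sphere, extended by a junk value. -/
noncomputable def radialProj (n : ℕ) (p : UBall n) : USphere n :=
  if h : p.1 = 0 then ⟨EuclideanSpace.single 0 1, by simp⟩
  else ⟨‖p.1‖⁻¹ • p.1, by
    rw [mem_sphere_zero_iff_norm, norm_smul, norm_inv, norm_norm,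
      inv_mul_cancel₀ (norm_ne_zero_iff.2 h)]⟩

theorem coe_radialProj {p : UBall n} (h : p.1 ≠ 0) : (radialProj n p).1 = ‖p.1‖⁻¹ • p.1 := by
  simp [radialProj, h]

theorem continuousOn_radialProj : ContinuousOn (radialProj n) {p | p.1 ≠ 0} := by
  rw [continuousOn_iff_continuous_domRestrict]
  refine continuous_induced_rng.2 ?_
  have : (Subtype.val ∘ Set.domRestrict {p : UBall n | p.1 ≠ 0} (radialProj n)) =
      fun p => ‖p.1.1‖⁻¹ • p.1.1 := by
    funext p
    exact coe_radialProj p.2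
  rw [this]
  exact Continuous.smul (Continuous.inv₀ (by fun_prop) fun p => norm_ne_zero_iff.2 p.2)
    (by fun_prop)

theorem radialProj_sphereIncl (p : USphere n) : radialProj n (sphereIncl n p) = p := by
  have h1 : ‖p.1‖ = 1 := mem_sphere_zero_iff_norm.1 p.2
  have h : (sphereIncl n p).1 ≠ 0 := by
    rw [← norm_ne_zero_iff]; change ‖p.1‖ ≠ 0; rw [h1]; exact one_ne_zero
  apply Subtype.ext
  rw [coe_radialProj h]
  change ‖p.1‖⁻¹ • p.1 = p.1
  rw [h1, inv_one, one_smul]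

theorem doubleInBall_of_norm_eq {p : UBall n} (h : ‖p.1‖ = 1 / 2) :
    doubleInBall n p = sphereIncl n (radialProj n p) := by
  have h0 : p.1 ≠ 0 := by rw [← norm_ne_zero_iff, h]; norm_num
  apply Subtype.ext
  change (max 1 ‖(2 : ℝ) • p.1‖)⁻¹ • ((2 : ℝ) • p.1) = (radialProj n p).1
  rw [coe_radialProj h0, norm_smul, h]
  norm_num

/-- A section over the end of a homotopy of loops yields one over its start: fill an annulus by the
homotopy. -/
theorem Fillable.of_homotopy {B C : Set (SphereMaps n X)} (hC : Fillable C)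
    (h : C(unitInterval × B, SphereMaps n X)) (h0 : ∀ b, h (0, b) = b) (h1 : ∀ b, h (1, b) ∈ C) :
    Fillable B := by
  obtain ⟨H, hH, hHs⟩ := fillable_iff_uncurry.1 hC
  rw [fillable_iff_uncurry]
  -- Time runs from `0` on the boundary to `1` at radius `1 / 2`; the inner half-size ball carries
  -- the given filling.
  let τ : UBall n → unitInterval := fun p => Set.projIcc 0 1 zero_le_one (2 - 2 * ‖p.1‖)
  have hτ : Continuous τ := continuous_projIcc.comp (by fun_prop)
  classical
  refine ⟨fun q => if ‖q.2.1‖ ≤ 1 / 2 then H (⟨h (1, q.1), h1 q.1⟩, doubleInBall n q.2)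
    else (h (τ q.2, q.1)).1 (radialProj n q.2), ?_, fun b p => ?_⟩
  · refine continuous_if_le (by fun_prop) continuous_const ?_ ?_ ?_
    · refine (hH.comp ?_).continuousOn
      exact ((h.continuous.comp (by fun_prop)).subtype_mk _).prodMk
        ((doubleInBall n).continuous.comp continuous_snd)
    · have hc : ContinuousOn (fun q : B × UBall n => radialProj n q.2) {q | 1 / 2 ≤ ‖q.2.1‖} := by
        refine continuousOn_radialProj.comp continuous_snd.continuousOn fun q hq => ?_
        have hq' : 1 / 2 ≤ ‖q.2.1‖ := hq
        exact norm_pos_iff.1 (by linarith)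
      have hl : Continuous fun q : B × UBall n => (h (τ q.2, q.1)).1 :=
        continuous_subtype_val.comp
          (h.continuous.comp ((hτ.comp continuous_snd).prodMk continuous_fst))
      have he : Continuous fun r : C(USphere n, X) × USphere n => r.1 r.2 := by fun_prop
      exact he.comp_continuousOn (hl.continuousOn.prodMk hc)
    · intro q hq
      have hτ1 : τ q.2 = 1 := by
        apply Set.projIcc_of_right_le
        rw [hq]; norm_num
      rw [doubleInBall_of_norm_eq hq, hHs, hτ1]
  · have hp : ‖(sphereIncl n p).1‖ = 1 := mem_sphere_zero_iff_norm.1 p.2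
    have hτ0 : τ (sphereIncl n p) = 0 := by
      apply Set.projIcc_of_le_left
      rw [hp]; norm_num
    simp only [hp, radialProj_sphereIncl, hτ0, h0]
    norm_num

/-- A cover of `C` is pulled back along the end map of the homotopy, and `Fillable.of_homotopy`
applies to each piece. -/
theorem SC_le_of_homotopy {B C : Set (SphereMaps n X)}
    (h : C(unitInterval × B, SphereMaps n X)) (h0 : ∀ b, h (0, b) = b) (h1 : ∀ b, h (1, b) ∈ C) :
    SC n X B ≤ SC n X C := by
  refine SC_le_of_forall fun m hm => ?_
  obtain ⟨U, hU, hUs⟩ := SC_le_iff.1 hm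
  have hc : Continuous fun b : B => h (1, b) := by fun_prop
  choose V hVo hV using fun i => isOpen_induced_iff.1 ((hUs i).1.preimage hc)
  refine SC_le_iff.2 ⟨V, fun b hb => ?_, fun i => ⟨hVo i, ?_⟩⟩
  · obtain ⟨i, hi⟩ := mem_iUnion.1 (hU (h1 ⟨b, hb⟩))
    refine mem_iUnion.2 ⟨i, ?_⟩
    change (⟨b, hb⟩ : B) ∈ Subtype.val ⁻¹' V i
    rw [hV i]; exact hi
  · refine (hUs i).2.of_homotopy
      (h.comp ((ContinuousMap.id _).prodMap ⟨Set.inclusion inter_subset_right,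
        continuous_inclusion _⟩)) (fun b => h0 _) fun b => ⟨?_, h1 _⟩
    have : (⟨b.1, b.2.2⟩ : B) ∈ Subtype.val ⁻¹' V i := b.2.1
    rw [hV i] at this
    exact this

end Homotopy

/-! ### Extending sections to neighbourhoods by the ANR property -/

section Neighbourhoods

variable {n : ℕ} {X : Type u} [TopologicalSpace X]

theorem IsMetrizableANR.metrizableSpace_sphereMaps (hX : IsMetrizableANR X) :
    TopologicalSpace.MetrizableSpace (SphereMaps n X) := by
  have := hX.1
  exact IsEmbedding.subtypeVal.metrizableSpace

/-- A section of `r_n` over a relatively closed subset of `A` extends to a neighbourhood in `A`. -/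
theorem Fillable.exists_isOpen (hX : IsMetrizableANR X) {A D : Set (SphereMaps n X)}
    (hD : IsClosed D) (h : Fillable (D ∩ A)) :
    ∃ W, IsOpen W ∧ D ∩ A ⊆ W ∧ Fillable (W ∩ A) := by
  classical
  have := hX.metrizableSpace_sphereMaps (n := n)
  obtain ⟨H, hH, hHs⟩ := fillable_iff_uncurry.1 h
  -- A section near `D` is an extension problem: the map to `X` is prescribed by `H` over `D` and by
  -- the loops themselves on the boundary sphere.
  let Z₁ : Set (A × UBall n) := {q | q.1.1 ∈ D}
  let Z₂ : Set (A × UBall n) := {q | ‖q.2.1‖ = 1}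
  have hZ₁ : IsClosed Z₁ := hD.preimage (by fun_prop)
  have hZ₂ : IsClosed Z₂ := isClosed_eq (by fun_prop) continuous_const
  have hsph : ∀ p : UBall n, ‖p.1‖ = 1 → p = sphereIncl n (radialProj n p) := fun p hp => by
    obtain ⟨p, hpb⟩ := p
    conv_rhs => rw [show (⟨p, hpb⟩ : UBall n) =
      sphereIncl n ⟨p, mem_sphere_zero_iff_norm.2 hp⟩ from rfl, radialProj_sphereIncl]
    rfl
  let f : A × UBall n → X := fun q =>
    if hq : q.1.1 ∈ D then H (⟨q.1.1, hq, q.1.2⟩, q.2) else q.1.1.1 (radialProj n q.2)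
  have hf₁ : ∀ q (hq : q ∈ Z₁), f q = H (⟨q.1.1, hq, q.1.2⟩, q.2) := fun q hq => dif_pos hq
  have hf₂ : ∀ q ∈ Z₂, f q = q.1.1.1 (radialProj n q.2) := fun q hq => by
    by_cases hD : q.1.1 ∈ D
    · rw [hf₁ q hD]
      conv_lhs => rw [hsph q.2 hq]
      exact hHs _ _
    · exact dif_neg hD
  have hfc : ContinuousOn f (Z₁ ∪ Z₂) := by
    refine ContinuousOn.union_of_isClosed ?_ ?_ hZ₁ hZ₂
    · rw [continuousOn_iff_continuous_domRestrict]
      have : Z₁.domRestrict f = fun q => H (⟨q.1.1.1, q.2, q.1.1.2⟩, q.1.2) := by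
        funext q; exact hf₁ q.1 q.2
      rw [this]
      exact hH.comp (by fun_prop)
    · refine ContinuousOn.congr ?_ hf₂
      have he : Continuous fun r : C(USphere n, X) × USphere n => r.1 r.2 := by fun_prop
      refine he.comp_continuousOn (ContinuousOn.prodMk (by fun_prop) ?_)
      refine continuousOn_radialProj.comp continuous_snd.continuousOn fun q hq => ?_
      have hq' : ‖q.2.1‖ = 1 := hq
      exact norm_ne_zero_iff.1 (by rw [hq']; exact one_ne_zero)
  obtain ⟨U, hZU, g, hU, hg⟩ := hX.2 (A × UBall n) (Z₁ ∪ Z₂) (hZ₁.union hZ₂)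
    ⟨(Z₁ ∪ Z₂).domRestrict f, continuousOn_iff_continuous_domRestrict.1 hfc⟩
  -- Tube lemma: the ball is compact, so the loops whose whole ball lies in `U` form an open set.
  have hW : IsOpen {a : A | ∀ p : UBall n, (a, p) ∈ U} := by
    rw [isOpen_iff_mem_nhds]
    intro a ha
    have := isCompact_univ.eventually_forall_of_forall_eventually (x₀ := a)
      (K := (univ : Set (UBall n))) (P := fun a p => (a, p) ∈ U)
      (fun p _ => hU.mem_nhds (ha p))
    filter_upwards [this] with b hb p using hb p (mem_univ p)
  obtain ⟨W, hWo, hWA⟩ := isOpen_induced_iff.1 hW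
  have hWmem : ∀ a : A, a.1 ∈ W ↔ ∀ p : UBall n, (a, p) ∈ U := fun a => by
    change a ∈ Subtype.val ⁻¹' W ↔ _
    rw [hWA]
    rfl
  refine ⟨W, hWo, fun a ha => (hWmem ⟨a, ha.2⟩).2 fun p => hZU (Or.inl ha.1), ?_⟩
  rw [fillable_iff_uncurry]
  refine ⟨fun q => g ⟨(⟨q.1.1, q.1.2.2⟩, q.2), (hWmem ⟨q.1.1, q.1.2.2⟩).1 q.1.2.1 q.2⟩,
    by fun_prop, fun b p => ?_⟩
  have hp : ((⟨b.1, b.2.2⟩, sphereIncl n p) : A × UBall n) ∈ Z₂ := mem_sphere_zero_iff_norm.1 p.2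
  refine (hg ⟨_, Or.inr hp⟩).trans ((hf₂ _ hp).trans ?_)
  rw [radialProj_sphereIncl]

/-- Enlarging a relatively closed set `B = D ∩ A` by a set with a section increases the complexity
by at most one. -/
theorem SC_le_add_one (hX : IsMetrizableANR X) {A B D W : Set (SphereMaps n X)}
    (hD : IsClosed D) (hW : IsOpen W) (hWA : Fillable (W ∩ A)) (hBA : B ⊆ A)
    (hB : B ⊆ D ∪ W) : SC n X B ≤ SC n X (D ∩ A) + 1 := by
  have := hX.metrizableSpace_sphereMaps (n := n)
  cases hC : SC n X (D ∩ A) with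
  | top => exact le_top
  | coe m =>
    obtain ⟨U, hU, hUs⟩ := SC_le_iff.1 hC.le
    -- By normality the open cover shrinks to a closed one, whose pieces have sections that extend
    -- to neighbourhoods in `A`.
    obtain ⟨v, hv, hvc, hvU⟩ := exists_subset_iUnion_closed_subset
      (hD.preimage (continuous_subtype_val (p := (· ∈ A))))
      (fun i => (hUs i).1.preimage continuous_subtype_val) (fun _ _ => toFinite _)
      (fun a ha => by simpa using hU ⟨ha, a.2⟩)
    choose E hEc hE using fun i => isClosed_induced_iff.1 (hvc i)
    have hEv : ∀ i (a : A), a.1 ∈ E i ↔ a ∈ v i := fun i a => by rw [← hE i]; rfl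
    have hex : ∀ i, ∃ V, IsOpen V ∧ (E i ∩ D) ∩ A ⊆ V ∧ Fillable (V ∩ A) := fun i =>
      ((hUs i).2.mono fun a ha =>
        ⟨hvU i ((hEv i ⟨a, ha.2⟩).1 ha.1.1), ha.1.2, ha.2⟩).exists_isOpen hX
          ((hEc i).inter hD)
    choose V hVo hEV hVs using hex
    refine (SC_le_iff (m := m + 1)).2 ⟨Fin.cons W V, fun b hb => ?_, fun i => ?_⟩
    · rw [mem_iUnion]
      rcases hB hb with h | h
      · obtain ⟨i, hi⟩ := mem_iUnion.1 (hv (show (⟨b, hBA hb⟩ : A) ∈ _ from h))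
        exact ⟨i.succ, hEV i ⟨⟨(hEv i _).2 hi, h⟩, hBA hb⟩⟩
      · exact ⟨0, h⟩
    · refine Fin.cases ?_ (fun i => ?_) i
      · exact ⟨hW, hWA.mono (inter_subset_inter_right _ hBA)⟩
      · exact ⟨hVo i, (hVs i).mono (inter_subset_inter_right _ hBA)⟩

end Neighbourhoods

/-! ### Uniform decrease of `F` from condition (D) -/

section Deformation

variable {Y : Type*} [TopologicalSpace Y] {F : C(Y, ℝ)} {φ : C(Y, Y)}

theorem ConditionD.apply_le (h : ConditionD F φ) (y : Y) : F (φ y) ≤ F y := by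
  by_cases hy : φ y = y
  · rw [hy]
  · exact (h.decreasing y hy).le

/-- Without a uniform drop, condition (D) would give a fixed point in the closure of `B`, which is
`B` itself. -/
theorem ConditionD.exists_uniform_drop (h : ConditionD F φ) {B : Set Y} (hB : IsClosed B) {K : ℝ}
    (hK : ∀ y ∈ B, |F y| ≤ K) (hfix : ∀ y ∈ B, φ y ≠ y) :
    ∃ ε > 0, ∀ y ∈ B, F (φ y) ≤ F y - ε := by
  by_contra! hcon
  obtain ⟨y, hyB, hy⟩ := h.closure_inter_fix B ⟨K, hK⟩ fun ε hε => by
    obtain ⟨y, hyB, hy⟩ := hcon ε hε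
    refine ⟨y, hyB, ?_⟩
    rw [abs_of_nonneg (sub_nonneg.2 (h.apply_le y))]
    linarith
  rw [hB.closure_eq] at hyB
  exact hfix y hyB hy

theorem ConditionD.exists_uniform_drop_of_Icc (h : ConditionD F φ) (a b : ℝ) {U : Set Y}
    (hU : IsOpen U) (hfix : ∀ y, a ≤ F y → F y ≤ b → φ y = y → y ∈ U) :
    ∃ ε > 0, ∀ y, a ≤ F y → F y ≤ b → y ∉ U → F (φ y) ≤ F y - ε := by
  have hc : IsClosed ({y | a ≤ F y ∧ F y ≤ b} ∩ Uᶜ) :=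
    ((isClosed_le continuous_const F.continuous).inter
      (isClosed_le F.continuous continuous_const)).inter hU.isClosed_compl
  obtain ⟨ε, hε, H⟩ := h.exists_uniform_drop hc (K := max |a| |b|)
    (fun y hy => abs_le_max_abs_abs hy.1.1 hy.1.2)
    (fun y hy hfy => hy.2 (hfix y hy.1.1 hy.1.2 hfy))
  exact ⟨ε, hε, fun y h1 h2 h3 => H y ⟨⟨h1, h2⟩, h3⟩⟩

end Deformation

/-! ### Counting critical values -/

section LusternikSchnirelmann

variable {n : ℕ} {X : Type u} [TopologicalSpace X] {A : Set (SphereMaps n X)} {F : C(A, ℝ)}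
  {φ : C(A, A)}

theorem sublevel_mono {a b : ℝ} (hab : a ≤ b) : sublevel F a ⊆ sublevel F b :=
  image_mono fun _ h => le_trans h hab

theorem sublevel_subset (a : ℝ) : sublevel F a ⊆ A := by
  rintro _ ⟨y, _, rfl⟩
  exact y.2

theorem ComplexityMonotone.SC_le_sublevel (hφ : ComplexityMonotone φ) {B : Set A} (hB : IsClosed B)
    {a : ℝ} (h : ∀ y ∈ B, F (φ y) ≤ a) : SC n X (Subtype.val '' B) ≤ SC n X (sublevel F a) := by
  refine (hφ B hB).trans (SC_mono (image_mono ?_))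
  rintro _ ⟨y, hy, rfl⟩
  exact h y hy

/-- The complexity of sublevel sets does not change across an interval without critical values. -/
theorem ComplexityMonotone.SC_sublevel_le_of_forall_ne (hφ : ComplexityMonotone φ)
    (hD : ConditionD F φ) {a b : ℝ} (hfix : ∀ y, a ≤ F y → F y ≤ b → φ y ≠ y) :
    SC n X (sublevel F b) ≤ SC n X (sublevel F a) := by
  obtain ⟨ε, hε, H⟩ := hD.exists_uniform_drop_of_Icc a b isOpen_empty
    fun y h1 h2 h3 => (hfix y h1 h2 h3).elim
  -- Each application of `φ` lowers the level by `ε` until it reaches `a`.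
  have key : ∀ k : ℕ, ∀ c ≤ b, c ≤ a + k * ε →
      SC n X (sublevel F c) ≤ SC n X (sublevel F a) := by
    intro k
    induction k with
    | zero => intro c _ hc; exact SC_mono (sublevel_mono (by simpa using hc))
    | succ k ih =>
      intro c hcb hc
      push_cast at hc
      rcases le_total c a with hca | hca
      · exact SC_mono (sublevel_mono hca)
      refine le_trans (hφ.SC_le_sublevel (isClosed_le F.continuous continuous_const)
        (a := max a (c - ε)) fun y hy => ?_) (ih _ (max_le (hca.trans hcb) (by linarith))
          (max_le (by nlinarith [Nat.cast_nonneg (α := ℝ) k]) (by linarith)))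
      have hy : F y ≤ c := hy
      rcases le_total a (F y) with hay | hay
      · exact (H y hay (hy.trans hcb) (notMem_empty y)).trans
          ((sub_le_sub_right hy ε).trans (le_max_right _ _))
      · exact (hD.apply_le y).trans (hay.trans (le_max_left _ _))
  obtain ⟨k, hk⟩ := exists_nat_ge ((b - a) / ε)
  refine key k b le_rfl ?_
  rw [div_le_iff₀ hε] at hk
  linarith

/-- Passing a single critical value increases the complexity of sublevel sets by at most one,
if the critical points have a neighbourhood with a section. -/
theorem ComplexityMonotone.SC_sublevel_le_add_one (hX : IsMetrizableANR X)
    (hφ : ComplexityMonotone φ) (hD : ConditionD F φ) {d c b : ℝ} (hdc : d < c) (hcb : c ≤ b)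
    {W : Set (SphereMaps n X)} (hW : IsOpen W) (hWA : Fillable (W ∩ A))
    (hfix : ∀ y, d ≤ F y → F y ≤ b → φ y = y → F y = c ∧ y.1 ∈ W) :
    SC n X (sublevel F b) ≤ SC n X (sublevel F d) + 1 := by
  obtain ⟨ε, hε, H⟩ := hD.exists_uniform_drop_of_Icc d b
    (hW.preimage (continuous_subtype_val (p := (· ∈ A)))) fun y h1 h2 h3 => (hfix y h1 h2 h3).2
  -- The margin `ε / 2` ensures that a drop by `ε` from level `a` lands strictly below `c`.
  set a := min b (c + ε / 2) with ha
  have hba : SC n X (sublevel F b) ≤ SC n X (sublevel F a) := by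
    rcases le_total b (c + ε / 2) with h | h
    · rw [ha, min_eq_left h]
    · rw [ha, min_eq_right h]
      refine hφ.SC_sublevel_le_of_forall_ne hD fun y h1 h2 h3 => ?_
      have := (hfix y (by linarith) h2 h3).1
      linarith
  have hB : IsClosed {y : A | F y ≤ a ∧ y.1 ∉ W} :=
    (isClosed_le F.continuous continuous_const).inter
      (hW.isClosed_compl.preimage continuous_subtype_val)
  -- Outside `W`, one application of `φ` passes below `c`; from there down to `d` no critical value
  -- remains.
  have hpush : SC n X (Subtype.val '' {y : A | F y ≤ a ∧ y.1 ∉ W}) ≤ SC n X (sublevel F d) := by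
    refine (hφ.SC_le_sublevel hB (a := max d (a - ε)) fun y hy => ?_).trans
      (hφ.SC_sublevel_le_of_forall_ne hD fun y h1 h2 h3 => ?_)
    · rcases le_total d (F y) with hdy | hdy
      · exact (H y hdy (hy.1.trans (min_le_left _ _)) hy.2).trans
          ((sub_le_sub_right hy.1 ε).trans (le_max_right _ _))
      · exact (hD.apply_le y).trans (hdy.trans (le_max_left _ _))
    · have hac : a - ε < c := by
        have := min_le_right b (c + ε / 2)
        rw [← ha] at this
        linarith
      have hyc : F y < c := h2.trans_lt (max_lt hdc hac)
      exact hyc.ne (hfix y h1 (hyc.le.trans hcb) h3).1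
  obtain ⟨D, hDc, hDB⟩ := isClosed_induced_iff.1 hB
  have hDA : D ∩ A = Subtype.val '' {y : A | F y ≤ a ∧ y.1 ∉ W} := by
    rw [← hDB, Subtype.image_preimage_coe, inter_comm]
  refine hba.trans ((SC_le_add_one hX hDc hW hWA (sublevel_subset a) ?_).trans
    (add_le_add_left (hDA ▸ hpush) 1))
  rintro _ ⟨y, hy, rfl⟩
  by_cases hyW : y.1 ∈ W
  · exact Or.inr hyW
  · exact Or.inl (hDA.symm ▸ mem_image_of_mem _ ⟨hy, hyW⟩ : y.1 ∈ D ∩ A).1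

/-- The complexity of a sublevel set is bounded by the number of critical values, if the critical
points have a neighbourhood with a section. -/
theorem ComplexityMonotone.SC_sublevel_le_encard (hX : IsMetrizableANR X)
    (hφ : ComplexityMonotone φ) (hD : ConditionD F φ) (hbdd : BddBelow (range F))
    {W : Set (SphereMaps n X)} (hW : IsOpen W) (hWA : Fillable (W ∩ A)) {lam : ℝ}
    (hfix : ∀ y, F y ≤ lam → φ y = y → y.1 ∈ W) :
    SC n X (sublevel F lam) ≤ (F '' Function.fixedPoints φ ∩ Iic lam).encard := by
  obtain ⟨m, hm⟩ := hbdd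
  have key : ∀ k : ℕ, ∀ b ≤ lam, (F '' Function.fixedPoints φ ∩ Iic b).encard ≤ k →
      SC n X (sublevel F b) ≤ k := by
    intro k
    induction k with
    | zero =>
      intro b _ hb
      have hb : F '' Function.fixedPoints φ ∩ Iic b = ∅ := by simpa using hb
      refine (hφ.SC_sublevel_le_of_forall_ne hD (a := m - 1) fun y _ h2 h3 => ?_).trans ?_
      · exact (hb ▸ ⟨mem_image_of_mem F h3, h2⟩ : F y ∈ (∅ : Set ℝ))
      · have : sublevel F (m - 1) = ∅ := by
          refine image_eq_empty.2 (eq_empty_of_forall_notMem fun y hy => ?_)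
          have h1 : m ≤ F y := hm (mem_range_self y)
          have h2 : F y ≤ m - 1 := hy
          linarith
        rw [this, SC_empty]; exact zero_le
    | succ k ih =>
      intro b hb hcard
      set C := F '' Function.fixedPoints φ ∩ Iic b with hC
      have hfin : C.Finite := finite_of_encard_le_coe hcard
      rcases C.eq_empty_or_nonempty with he | hne
      · exact (ih b hb (by rw [← hC, he]; simp)).trans (by exact_mod_cast k.le_succ)
      obtain ⟨c, hcC, hc⟩ := hfin.exists_maximal hne
      -- `c` is the top critical value up to `b`; a level `d < c` above all the others leaves one
      -- critical value fewer for the induction.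
      have hcmax : ∀ x ∈ C, x ≤ c := fun x hx => by
        rcases le_total x c with h | h
        · exact h
        · exact hc hx h
      obtain ⟨d, hdc, hd⟩ : ∃ d < c, ∀ x ∈ C, x < c → x < d := by
        rcases (C ∩ Iio c).eq_empty_or_nonempty with he | hne'
        · exact ⟨c - 1, by linarith, fun x hx hxc => (he ▸ ⟨hx, hxc⟩ : x ∈ (∅ : Set ℝ)).elim⟩
        · obtain ⟨e, heC, he⟩ := (hfin.subset inter_subset_left).exists_maximal hne'
          have hec : e < c := heC.2
          refine ⟨(e + c) / 2, by linarith, fun x hx hxc => ?_⟩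
          rcases le_total x e with h | h
          · linarith
          · have := he ⟨hx, hxc⟩ h
            linarith
      have hsub : insert c (F '' Function.fixedPoints φ ∩ Iic d) ⊆ C :=
        insert_subset hcC fun x hx => ⟨hx.1, hx.2.trans (hdc.le.trans hcC.2)⟩
      have hnot : c ∉ F '' Function.fixedPoints φ ∩ Iic d := fun h => not_lt.2 h.2 hdc
      have hcard' := (encard_le_encard hsub).trans hcard
      rw [encard_insert_of_notMem hnot, Nat.cast_add, Nat.cast_one] at hcard'
      refine (hφ.SC_sublevel_le_add_one hX hD hdc hcC.2 hW hWA fun y h1 h2 h3 => ⟨?_, ?_⟩).trans ?_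
      · have hyC : F y ∈ C := ⟨mem_image_of_mem F h3, h2⟩
        by_contra hne
        exact not_lt.2 h1 (hd _ hyC (lt_of_le_of_ne (hcmax _ hyC) hne))
      · exact hfix y (h2.trans hb) h3
      · rw [Nat.cast_add, Nat.cast_one]
        exact add_le_add_left (ih d (hdc.le.trans (hcC.2.trans hb))
          ((ENat.add_le_add_iff_right ENat.one_ne_top).1 hcard')) 1
  cases hk : (F '' Function.fixedPoints φ ∩ Iic lam).encard with
  | top => exact le_top
  | coe k => exact key k lam le_rfl hk.le

end LusternikSchnirelmann

/-! ### Filling a loop compatibly with its rotational symmetry -/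

section Circle

variable {X : Type*} [TopologicalSpace X]

/-- The covering `t ↦ exp (2πit)` of the circle by the line. -/
noncomputable def circleParam : C(ℝ, Circle) where
  toFun t := Circle.exp (2 * Real.pi * t)

theorem circleParam_add (s t : ℝ) : circleParam (s + t) = circleParam s * circleParam t := by
  simp [circleParam, mul_add, Circle.exp_add]

theorem circleParam_zero : circleParam 0 = 1 := by simp [circleParam]

theorem circleParam_natCast_mul (k : ℕ) (t : ℝ) : circleParam (k * t) = circleParam t ^ k := by
  simp only [circleParam, ContinuousMap.coe_mk]
  rw [mul_left_comm, Circle.exp_natCast_mul]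

theorem circleParam_eq_iff {s t : ℝ} : circleParam s = circleParam t ↔ ∃ k : ℤ, s = t + k := by
  simp only [circleParam, ContinuousMap.coe_mk]
  rw [Circle.exp_eq_exp]
  have := Real.pi_pos
  refine exists_congr fun k => ⟨fun h => ?_, fun h => by rw [h]; ring⟩
  have h' : 2 * Real.pi * s = 2 * Real.pi * (t + k) := by rw [h]; ring
  exact mul_left_cancel₀ (by positivity) h'

theorem circleParam_one : circleParam 1 = 1 := by simp [circleParam]

theorem circleParam_surjective : Function.Surjective circleParam := fun z => by
  obtain ⟨x, rfl⟩ := Circle.exp_surjective z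
  have := Real.pi_pos
  refine ⟨x / (2 * Real.pi), ?_⟩
  simp only [circleParam, ContinuousMap.coe_mk]
  congr 1
  field_simp

/-- The closed unit disc in the complex plane. -/
abbrev ComplexDisc : Type := Metric.closedBall (0 : ℂ) 1

/-- The inclusion of the circle into the disc. -/
def circleIncl : C(Circle, ComplexDisc) where
  toFun z := ⟨z, mem_closedBall_zero_iff.2 (Circle.norm_coe z).le⟩

/-- Polar coordinates on the disc. -/
noncomputable def polarDisc : C(Circle × unitInterval, ComplexDisc) where
  toFun q := ⟨(q.2 : ℝ) • (q.1 : ℂ), by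
    rw [mem_closedBall_zero_iff, norm_smul, Circle.norm_coe, mul_one,
      Real.norm_of_nonneg q.2.2.1]
    exact q.2.2.2⟩

theorem coe_polarDisc (q : Circle × unitInterval) :
    (polarDisc q : ℂ) = (q.2 : ℝ) • (q.1 : ℂ) := rfl

theorem polarDisc_one (z : Circle) : polarDisc (z, 1) = circleIncl z :=
  Subtype.ext (one_smul _ _)

theorem polarDisc_surjective : Function.Surjective polarDisc := fun z => by
  refine ⟨(Circle.exp (Complex.arg z), ⟨‖z.1‖, norm_nonneg _, mem_closedBall_zero_iff.1 z.2⟩),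
    Subtype.ext ?_⟩
  rw [coe_polarDisc, Circle.coe_exp, Complex.real_smul]
  exact Complex.norm_mul_exp_arg_mul_I _

theorem polarDisc_eq_iff {q r : Circle × unitInterval} :
    polarDisc q = polarDisc r ↔ q.2 = r.2 ∧ (q.2 = 0 ∨ q.1 = r.1) := by
  constructor
  · intro h
    have h : (q.2 : ℝ) • (q.1 : ℂ) = (r.2 : ℝ) • (r.1 : ℂ) := congrArg Subtype.val h
    have hn := congrArg norm h
    rw [norm_smul, norm_smul, Circle.norm_coe, Circle.norm_coe, mul_one, mul_one,
      Real.norm_of_nonneg q.2.2.1, Real.norm_of_nonneg r.2.2.1] at hn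
    refine ⟨Subtype.ext hn, or_iff_not_imp_left.2 fun h0 => ?_⟩
    rw [← hn] at h
    have h0' : (q.2 : ℝ) ≠ 0 := fun h' => h0 (Subtype.ext h')
    exact Circle.ext (smul_right_injective ℂ h0' h)
  · rintro ⟨h, h'⟩
    apply Subtype.ext
    rw [coe_polarDisc, coe_polarDisc, ← h]
    rcases h' with h' | h'
    · simp [h']
    · rw [h']

/-- Polar coordinates present the disc as the cylinder with one end collapsed, where the
nullhomotopy is constant. -/
theorem ContinuousMap.Nullhomotopic.exists_extension_disc {f : C(Circle, X)}
    (hf : f.Nullhomotopic) : ∃ u : C(ComplexDisc, X), ∀ z, u (circleIncl z) = f z := by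
  obtain ⟨x, ⟨H⟩⟩ := hf
  have hq : IsQuotientMap polarDisc :=
    polarDisc.continuous.isClosedMap.isQuotientMap polarDisc.continuous polarDisc_surjective
  let K : C(Circle × unitInterval, X) := ⟨fun q => H (unitInterval.symm q.2, q.1), by fun_prop⟩
  have hK : ∀ q, q.2 = 0 → K q = x := fun q h => by
    change H (unitInterval.symm q.2, q.1) = x
    rw [h, unitInterval.symm_zero, H.apply_one]; rfl
  have hfac : Function.FactorsThrough K polarDisc := fun q r h => by
    obtain ⟨h1, h2⟩ := polarDisc_eq_iff.1 h
    rcases h2 with h2 | h2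
    · rw [hK q h2, hK r (h1 ▸ h2)]
    · rw [Prod.ext h2 h1]
  refine ⟨hq.lift (f := polarDisc) K hfac, fun z => ?_⟩
  rw [← polarDisc_one]
  refine (DFunLike.congr_fun (hq.lift_comp (f := polarDisc) K hfac) (z, 1)).trans ?_
  change H (unitInterval.symm 1, z) = f z
  rw [unitInterval.symm_one, H.apply_zero]

theorem Path.homotopic_of_simplyConnected {B : Type*} [TopologicalSpace B]
    [SimplyConnectedSpace B] (u : C(B, X)) {b b' : B} (l l' : Path b b') {x y : X}
    (p p' : Path x y) (h : ∀ t, p t = u (l t)) (h' : ∀ t, p' t = u (l' t)) : p.Homotopic p' := by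
  obtain rfl : x = u b := by simpa using h 0
  obtain rfl : y = u b' := by simpa using h 1
  have e : p = l.map u.continuous := Path.ext (funext h)
  have e' : p' = l'.map u.continuous := Path.ext (funext h')
  rw [e, e']
  exact (SimplyConnectedSpace.paths_homotopic l l').map u

/-- The loop `t ↦ g (k t)` on the unit interval, for a function `g` of period one. -/
def periodicLoop (g : C(ℝ, X)) (hg : Function.Periodic g 1) (k : ℕ) : Path (g 0) (g 0) where
  toFun t := g (k * t)
  source' := by simp
  target' := by simpa using hg.nat_mul_eq k

/-- Both sides come from paths in `ℝ` with the same endpoints. Periodicity identifies the lift's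
last unit segment with one turn of the loop. -/
theorem fromPath_periodicLoop (g : C(ℝ, X)) (hg : Function.Periodic g 1) (k : ℕ) :
    FundamentalGroup.fromPath (.mk (periodicLoop g hg k)) =
      (FundamentalGroup.fromPath (.mk (periodicLoop g hg 1))) ^ k := by
  let L : (a b : ℝ) → Path a b := fun a b =>
    { toFun := fun t => a + t * (b - a)
      source' := by simp
      target' := by simp }
  induction k with
  | zero =>
    rw [pow_zero, FundamentalGroup.one_def, ← Path.Homotopic.Quotient.mk_refl]
    refine congrArg Path.Homotopic.Quotient.mk (Path.ext (funext fun t => ?_))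
    simp [periodicLoop]
  | succ k ih =>
    rw [pow_succ', ← ih, FundamentalGroup.mul_def]
    refine (Path.Homotopic.Quotient.eq.2 ?_).trans (Path.Homotopic.Quotient.mk_trans _ _)
    refine Path.homotopic_of_simplyConnected g (L 0 (k + 1)) ((L 0 k).trans (L k (k + 1))) _ _
      (fun t => ?_) fun t => ?_
    · simp [periodicLoop, L, mul_comm]
    · rw [Path.trans_apply, Path.trans_apply]
      split_ifs
      · simp [periodicLoop, L, mul_comm]
      · simp only [periodicLoop, L, Path.coe_mk_mk]
        have := hg.nat_mul k (2 * t - 1)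
        rw [Nat.cast_one, one_mul, ← this]
        congr 1
        ring

theorem exists_extension_disc_of_homotopic_refl (g : C(ℝ, X)) (hg : Function.Periodic g 1)
    (h : (periodicLoop g hg 1).Homotopic (Path.refl _)) :
    ∃ u : C(ComplexDisc, X), ∀ t, u (circleIncl (circleParam t)) = g t := by
  obtain ⟨H⟩ := h
  let q : C(unitInterval × unitInterval, ComplexDisc) :=
    polarDisc.comp ⟨fun r => (circleParam r.1, r.2), by fun_prop⟩
  have hfract : ∀ t : ℝ, Int.fract t ∈ unitInterval := fun t =>
    ⟨Int.fract_nonneg _, (Int.fract_lt_one _).le⟩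
  have hparam : ∀ t : ℝ, circleParam (Int.fract t) = circleParam t := fun t =>
    circleParam_eq_iff.2 ⟨-⌊t⌋, by rw [Int.fract]; push_cast; ring⟩
  have hqs : Function.Surjective q := fun z => by
    obtain ⟨⟨w, s⟩, rfl⟩ := polarDisc_surjective z
    obtain ⟨t, rfl⟩ := circleParam_surjective w
    exact ⟨(⟨Int.fract t, hfract t⟩, s), by simp [q, hparam]⟩
  have hq : IsQuotientMap q := q.continuous.isClosedMap.isQuotientMap q.continuous hqs
  let K : C(unitInterval × unitInterval, X) :=
    ⟨fun r => H (unitInterval.symm r.2, r.1), by fun_prop⟩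
  have hK0 : ∀ r, r.2 = 0 → K r = g 0 := fun r h => by
    change H (unitInterval.symm r.2, r.1) = g 0
    rw [h, unitInterval.symm_zero, H.apply_one]; rfl
  have hK1 : ∀ r, (r.1 = 0 ∨ r.1 = 1) → K r = g 0 := fun r h => by
    change H (unitInterval.symm r.2, r.1) = g 0
    rcases h with h | h <;> rw [h]
    · exact Path.Homotopy.source H _
    · exact Path.Homotopy.target H _
  have hfac : Function.FactorsThrough K q := fun a b h => by
    obtain ⟨h1, h2⟩ := polarDisc_eq_iff.1 h
    simp only [ContinuousMap.coe_mk] at h1 h2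
    rcases h2 with h2 | h2
    · rw [hK0 a h2, hK0 b (h1 ▸ h2)]
    · obtain ⟨k, hk⟩ := circleParam_eq_iff.1 h2
      have ha := a.1.2
      have hb := b.1.2
      have hk1 : k ≤ 1 := by
        have : (k : ℝ) ≤ 1 := by linarith [ha.2, hb.1]
        exact_mod_cast this
      have hk2 : -1 ≤ k := by
        have : (-1 : ℝ) ≤ k := by linarith [ha.1, hb.2]
        exact_mod_cast this
      -- Distinct angles in the unit interval give the same circle point only at `0` and `1`, where
      -- a path homotopy is stationary.
      obtain rfl | rfl | rfl : k = -1 ∨ k = 0 ∨ k = 1 := by omega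
      · push_cast at hk
        rw [hK1 a (Or.inl (Subtype.ext (by rw [Set.Icc.coe_zero]; linarith [ha.1, ha.2, hb.1, hb.2]))),
          hK1 b (Or.inr (Subtype.ext (by rw [Set.Icc.coe_one]; linarith [ha.1, ha.2, hb.1, hb.2])))]
      · have : a = b := Prod.ext (Subtype.ext (by simpa using hk)) h1
        rw [this]
      · push_cast at hk
        rw [hK1 a (Or.inr (Subtype.ext (by rw [Set.Icc.coe_one]; linarith [ha.1, ha.2, hb.1, hb.2]))),
          hK1 b (Or.inl (Subtype.ext (by rw [Set.Icc.coe_zero]; linarith [ha.1, ha.2, hb.1, hb.2])))]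
  refine ⟨hq.lift (f := q) K hfac, fun t => ?_⟩
  have e : circleIncl (circleParam t) = q (⟨Int.fract t, hfract t⟩, 1) := by
    rw [← hparam, ← polarDisc_one]; rfl
  rw [e]
  refine (DFunLike.congr_fun (hq.lift_comp (f := q) K hfac) _).trans ?_
  change H (unitInterval.symm 1, ⟨Int.fract t, hfract t⟩) = g t
  rw [unitInterval.symm_one, H.apply_zero]
  change g ((1 : ℕ) * Int.fract t) = g t
  rw [Nat.cast_one, one_mul, Int.fract, ← mul_one (⌊t⌋ : ℝ), hg.sub_int_mul_eq]

/-- A nullhomotopic loop in a space with torsion-free fundamental group is, up to an `m`-fold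
covering of the circle, the boundary of a disc, where `m` is the order of the group of rotations
fixing the loop (and `m = 0` if the loop is constant). -/
theorem exists_disc_of_nullhomotopic [T2Space X] (hpi : HasTorsionFreePi1 X) {γ : C(Circle, X)}
    (hγ : γ.Nullhomotopic) : ∃ (m : ℕ) (u : C(ComplexDisc, X)),
      (∀ z, u (circleIncl (z ^ m)) = γ z) ∧ ∀ w, (∀ z, γ (w * z) = γ z) → w ^ m = 1 := by
  let G : C(ℝ, X) := γ.comp circleParam
  have hG1 : Function.Periodic G 1 := fun t => by
    change γ (circleParam (t + 1)) = γ (circleParam t)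
    rw [circleParam_add, circleParam_one, mul_one]
  let P : AddSubgroup ℝ :=
    { carrier := {a | ∀ t, G (t + a) = G t}
      add_mem' := fun {a b} ha hb t => by rw [← add_assoc, hb, ha]
      zero_mem' := fun t => by rw [add_zero]
      neg_mem' := fun {a} ha t => by rw [← ha (t + -a), neg_add_cancel_right] }
  have hPmem : ∀ a, a ∈ P ↔ ∀ t, G (t + a) = G t := fun a => Iff.rfl
  have hPc : IsClosed (P : Set ℝ) := by
    have : (P : Set ℝ) = ⋂ t, {a | G (t + a) = G t} := by
      ext a
      rw [mem_iInter]
      exact hPmem a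
    rw [this]
    exact isClosed_iInter fun t => isClosed_eq (by fun_prop) continuous_const
  -- A closed dense group of periods is all of `ℝ`, so the loop is constant and `m = 0` works.
  rcases P.dense_or_cyclic with hP | ⟨a, ha⟩
  · refine ⟨0, ContinuousMap.const _ (γ 1), fun z => ?_, fun w _ => pow_zero w⟩
    obtain ⟨t, rfl⟩ := circleParam_surjective z
    have ht : t ∈ (P : Set ℝ) := by
      rw [← hPc.closure_eq, hP.closure_eq]; exact mem_univ t
    have := (hPmem t).1 ht 0
    rw [zero_add] at this
    change γ 1 = G t
    rw [this, ← circleParam_zero]; rfl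
  · have hmem : ∀ s, s ∈ P ↔ ∃ k : ℤ, k * a = s := fun s => by
      rw [ha, AddSubgroup.mem_closure_singleton]; simp
    obtain ⟨k, hk⟩ := (hmem 1).1 hG1
    have hk0 : k ≠ 0 := by rintro rfl; simp at hk
    set m := k.natAbs with hm
    have hm0 : 0 < m := Int.natAbs_pos.2 hk0
    have hm0' : (m : ℝ) ≠ 0 := by exact_mod_cast hm0.ne'
    -- The generator `a` may be negative: `ε` is the sign for which `m * a = ε`, so `1 / m = ε * a`
    -- is a period.
    obtain ⟨ε, hε⟩ : ∃ ε : ℤ, (m : ℝ) * a = ε := by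
      have : (m : ℝ) = |(k : ℝ)| := by rw [hm, Nat.cast_natAbs]; simp
      rcases abs_choice (k : ℝ) with h | h
      · exact ⟨1, by rw [this, h, hk]; simp⟩
      · exact ⟨-1, by rw [this, h, neg_mul, hk]; simp⟩
    have hεε : (ε : ℝ) * ε = 1 := by
      have h1 : (m : ℝ) = |(k : ℝ)| := by rw [hm, Nat.cast_natAbs]; simp
      have h2 : |(ε : ℝ)| = 1 := by rw [← hε, h1, abs_mul, abs_abs, ← abs_mul, hk, abs_one]
      rw [← abs_mul_abs_self, h2, one_mul]
    have hinv : (m : ℝ)⁻¹ ∈ P := by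
      refine (hmem _).2 ⟨ε, ?_⟩
      rw [← mul_right_cancel_iff_of_pos (Nat.cast_pos.2 hm0 : (0 : ℝ) < m), inv_mul_cancel₀ hm0', mul_assoc, mul_comm a, hε, hεε]
    let g : C(ℝ, X) := ⟨fun t => G (t * (m : ℝ)⁻¹), by fun_prop⟩
    have hg : Function.Periodic g 1 := fun t => by
      change G ((t + 1) * (m : ℝ)⁻¹) = G (t * (m : ℝ)⁻¹)
      rw [add_mul, one_mul]
      exact hinv _
    have hgG : ∀ t, g (m * t) = G t := fun t => by
      change G (m * t * (m : ℝ)⁻¹) = G t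
      rw [mul_comm (m : ℝ), mul_inv_cancel_right₀ hm0']
    have : ContractibleSpace ComplexDisc :=
      (convex_closedBall (0 : ℂ) 1).contractibleSpace ⟨0, by simp⟩
    obtain ⟨v, hv⟩ := hγ.exists_extension_disc
    let l : Path (circleIncl 1) (circleIncl 1) :=
      { toFun := fun t => circleIncl (circleParam t)
        source' := by simp [circleParam_zero]
        target' := by simp [circleParam_one] }
    -- The `m`-fold loop of `g` is `γ`, which bounds the disc `v`; torsion-freeness then kills the
    -- simple loop of `g`.
    have hloop : (periodicLoop g hg m).Homotopic (Path.refl _) := by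
      refine Path.homotopic_of_simplyConnected v l (Path.refl _) _ _ (fun t => ?_) fun t => ?_
      · exact (hgG t).trans (hv _).symm
      · refine Eq.trans ?_ (hv _).symm
        change G (0 * (m : ℝ)⁻¹) = γ 1
        rw [zero_mul, ← circleParam_zero]; rfl
    have hpow := fromPath_periodicLoop g hg m
    have hone : FundamentalGroup.fromPath (.mk (periodicLoop g hg 1)) = 1 :=
      hpi (g 0) _ (isOfFinOrder_iff_pow_eq_one.2
        ⟨m, hm0, hpow.symm.trans (Path.Homotopic.Quotient.eq.2 hloop)⟩)
    obtain ⟨u, hu⟩ := exists_extension_disc_of_homotopic_refl g hg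
      (Path.Homotopic.Quotient.eq.1 hone)
    refine ⟨m, u, fun z => ?_, fun w hw => ?_⟩
    · obtain ⟨t, rfl⟩ := circleParam_surjective z
      rw [← circleParam_natCast_mul, hu, hgG]; rfl
    · obtain ⟨s, rfl⟩ := circleParam_surjective w
      have hs : s ∈ P := fun t => by
        change γ (circleParam (t + s)) = γ (circleParam t)
        rw [add_comm, circleParam_add, hw]
      obtain ⟨j, hj⟩ := (hmem s).1 hs
      rw [← circleParam_natCast_mul, ← circleParam_zero]
      refine circleParam_eq_iff.2 ⟨j * ε, ?_⟩
      rw [← hj, zero_add, mul_left_comm, hε]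
      push_cast; rfl

end Circle

/-! ### Gluing sections over disjoint closed sets; constant loops -/

section Union

variable {n : ℕ} {X : Type*} [TopologicalSpace X]

theorem Fillable.union_of_disjoint {B C : Set (SphereMaps n X)} (hB : Fillable B) (hC : Fillable C)
    (hBc : IsClosed B) (hCc : IsClosed C) (hBC : Disjoint B C) : Fillable (B ∪ C) := by
  classical
  obtain ⟨s, hs⟩ := hB
  obtain ⟨t, ht⟩ := hC
  have hmem : ∀ b : ↥(B ∪ C), b.1 ∉ B → b.1 ∈ C := fun b hb => b.2.resolve_left hb
  let f : ↥(B ∪ C) → BallMaps n X := fun b =>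
    if hb : b.1 ∈ B then s ⟨b.1, hb⟩ else t ⟨b.1, hmem b hb⟩
  have hf₁ : ∀ b (hb : b.1 ∈ B), f b = s ⟨b.1, hb⟩ := fun b hb => dif_pos hb
  have hf₂ : ∀ b (hb : b.1 ∈ C), f b = t ⟨b.1, hb⟩ := fun b hb =>
    dif_neg (disjoint_right.1 hBC hb)
  refine ⟨⟨f, ?_⟩, fun b => ?_⟩
  · rw [← continuousOn_univ]
    have hu : (univ : Set ↥(B ∪ C)) = {b | b.1 ∈ B} ∪ {b | b.1 ∈ C} :=
      (eq_univ_of_forall fun b => b.2).symm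
    rw [hu]
    refine ContinuousOn.union_of_isClosed ?_ ?_ (hBc.preimage continuous_subtype_val)
      (hCc.preimage continuous_subtype_val)
    · rw [continuousOn_iff_continuous_domRestrict]
      exact Continuous.congr (f := fun b => s ⟨b.1.1, b.2⟩) (by fun_prop)
        fun b => (hf₁ b.1 b.2).symm
    · rw [continuousOn_iff_continuous_domRestrict]
      exact Continuous.congr (f := fun b => t ⟨b.1.1, b.2⟩) (by fun_prop)
        fun b => (hf₂ b.1 b.2).symm
  · change restrictToSphere n X (f b) = b
    rcases b.2 with hb | hb
    · rw [hf₁ b hb, hs]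
    · rw [hf₂ b hb, ht]

theorem Fillable.biUnion_finset (S : Finset (Set (SphereMaps n X)))
    (hfill : ∀ O ∈ S, Fillable O) (hclosed : ∀ O ∈ S, IsClosed O)
    (hdisj : ∀ O ∈ S, ∀ O' ∈ S, O ≠ O' → Disjoint O O') : Fillable (⋃ O ∈ S, O) := by
  classical
  induction S using Finset.induction_on with
  | empty => simpa using fillable_empty
  | insert O S hO ih =>
    rw [Finset.set_biUnion_insert]
    simp only [Finset.forall_mem_insert] at hfill hclosed hdisj
    refine hfill.1.union_of_disjoint
      (ih hfill.2 hclosed.2 fun P hP Q hQ => (hdisj.2 P hP).2 Q hQ) hclosed.1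
      (S.finite_toSet.isClosed_biUnion hclosed.2) ?_
    rw [disjoint_iUnion₂_right]
    exact fun P hP => hdisj.1.2 P hP fun h => hO (h ▸ hP)

/-- A point of the sphere. -/
noncomputable def spherePoint (n : ℕ) : USphere n := ⟨EuclideanSpace.single 0 1, by simp⟩

theorem mem_constMaps_iff {γ : SphereMaps n X} :
    γ ∈ constMaps n X ↔ ∀ p, γ.1 p = γ.1 (spherePoint n) :=
  ⟨fun ⟨_, hx⟩ p => (hx p).trans (hx _).symm, fun h => ⟨_, h⟩⟩

theorem isClosed_constMaps [T2Space X] : IsClosed (constMaps n X) := by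
  have : constMaps n X = ⋂ p, {γ | γ.1 p = γ.1 (spherePoint n)} := by
    ext γ
    rw [mem_iInter]
    exact mem_constMaps_iff
  rw [this]
  exact isClosed_iInter fun p => isClosed_eq (by fun_prop) (by fun_prop)

theorem fillable_constMaps : Fillable (constMaps n X) :=
  fillable_iff_uncurry.2 ⟨fun q => q.1.1.1 (spherePoint n), by fun_prop,
    fun b p => (mem_constMaps_iff.1 b.2 p).symm⟩

end Union

/-! ### Rotation orbits and their sections -/

section Rotations

variable {X : Type*} [TopologicalSpace X]

/-- The identification of the Euclidean plane with the complex plane. -/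
noncomputable def eucToComplex : Euc 1 ≃ₗᵢ[ℝ] ℂ := Complex.orthonormalBasisOneI.repr.symm

theorem eucToComplex_apply (v : Euc 1) : eucToComplex v = v 0 + v 1 * Complex.I := rfl

/-- The identification of `S^1` with the circle group. -/
noncomputable def sphereToCircle : C(USphere 1, Circle) where
  toFun p := ⟨eucToComplex p.1, mem_sphere_zero_iff_norm.2 <| by
    rw [LinearIsometryEquiv.norm_map]; exact mem_sphere_zero_iff_norm.1 p.2⟩
  continuous_toFun := by
    refine Continuous.subtype_mk ?_ _
    exact eucToComplex.continuous.comp continuous_subtype_val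

theorem coe_sphereToCircle (p : USphere 1) : (sphereToCircle p : ℂ) = eucToComplex p.1 := rfl

/-- The inverse of `sphereToCircle`. -/
noncomputable def circleToSphere : C(Circle, USphere 1) where
  toFun z := ⟨eucToComplex.symm z, mem_sphere_zero_iff_norm.2 <| by
    rw [LinearIsometryEquiv.norm_map, Circle.norm_coe]⟩
  continuous_toFun := by
    refine Continuous.subtype_mk ?_ _
    exact eucToComplex.symm.continuous.comp continuous_subtype_val

theorem sphereToCircle_circleToSphere (z : Circle) : sphereToCircle (circleToSphere z) = z :=
  Circle.ext (eucToComplex.apply_symm_apply _)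

theorem circleToSphere_sphereToCircle (p : USphere 1) : circleToSphere (sphereToCircle p) = p :=
  Subtype.ext (eucToComplex.symm_apply_apply _)

theorem sphereToCircle_injective : Function.Injective sphereToCircle :=
  Function.LeftInverse.injective circleToSphere_sphereToCircle

/-- The rotation of `S^1` by `w`. -/
noncomputable def rotSphere (w : Circle) : C(USphere 1, USphere 1) where
  toFun p := circleToSphere (w * sphereToCircle p)

/-- The complex conjugation on `S^1`. -/
noncomputable def conjSphere : C(USphere 1, USphere 1) where
  toFun p := circleToSphere (sphereToCircle p)⁻¹

theorem rotSphere_apply (w : Circle) (p : USphere 1) :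
    rotSphere w p = circleToSphere (w * sphereToCircle p) := rfl

theorem rotSphere_rotSphere (w z : Circle) (p : USphere 1) :
    rotSphere w (rotSphere z p) = rotSphere (w * z) p := by
  simp only [rotSphere_apply, sphereToCircle_circleToSphere, mul_assoc]

theorem rotSphere_one (p : USphere 1) : rotSphere 1 p = p := by
  rw [rotSphere_apply, one_mul, circleToSphere_sphereToCircle]

/-- An orthogonal transformation of the plane is a rotation or a rotation followed by the complex
conjugation. -/
theorem exists_orthOnSphere_eq (N : OrthGroup 1) :
    ∃ w, orthOnSphere N = rotSphere w ∨ orthOnSphere N = conjSphere.comp (rotSphere w) := by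
  have hN := (Matrix.mem_orthogonalGroup_iff' (Fin 2) ℝ).1 N.2
  have h00 := congrFun (congrFun hN 0) 0
  have h01 := congrFun (congrFun hN 0) 1
  have h11 := congrFun (congrFun hN 1) 1
  simp only [Matrix.mul_apply, Fin.sum_univ_two, Matrix.transpose_apply, Matrix.one_apply_eq]
    at h00 h01 h11
  rw [Matrix.one_apply_ne (by decide)] at h01
  have hp : ∀ p : USphere 1, (sphereToCircle (orthOnSphere N p) : ℂ) =
      ((N.1 0 0 * p.1 0 + N.1 0 1 * p.1 1 : ℝ) : ℂ) +
        ((N.1 1 0 * p.1 0 + N.1 1 1 * p.1 1 : ℝ) : ℂ) * Complex.I := fun p => by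
    rw [coe_sphereToCircle, eucToComplex_apply]
    simp [orthOnSphere]
  set a := N.1 0 0
  set b := N.1 0 1
  set c := N.1 1 0
  set d := N.1 1 1
  -- The determinant squares to `1`, and orthogonality expresses the second column through it and
  -- the first.
  have hdet : (a * d - b * c) * (a * d - b * c) = 1 := by
    linear_combination (b * b + d * d) * h00 + h11 - (a * b + c * d) * h01
  have hd : d = a * (a * d - b * c) := by linear_combination (-d) * h00 + c * h01
  have hb : b = -c * (a * d - b * c) := by linear_combination (-b) * h00 + a * h01
  rcases mul_self_eq_one_iff.1 hdet with h | h
  · obtain ⟨w, hw⟩ : ∃ w : Circle, (w : ℂ) = ⟨a, c⟩ :=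
      ⟨⟨⟨a, c⟩, mem_sphere_zero_iff_norm.2 <| by
        rw [← sq_eq_sq₀ (norm_nonneg _) zero_le_one, ← Complex.normSq_eq_norm_sq,
          Complex.normSq_mk]
        linarith⟩, rfl⟩
    refine ⟨w, Or.inl (ContinuousMap.ext fun p =>
      sphereToCircle_injective (Circle.ext ?_))⟩
    rw [hp, rotSphere_apply, sphereToCircle_circleToSphere, Circle.coe_mul, coe_sphereToCircle,
      eucToComplex_apply, hw]
    rw [h] at hd hb
    rw [hd, hb]
    apply Complex.ext <;> simp <;> ring
  -- For determinant `-1` conjugation comes after the rotation, so `w` is the conjugate of the first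
  -- column `a + c * I`.
  · obtain ⟨w, hw⟩ : ∃ w : Circle, (w : ℂ) = ⟨a, -c⟩ :=
      ⟨⟨⟨a, -c⟩, mem_sphere_zero_iff_norm.2 <| by
        rw [← sq_eq_sq₀ (norm_nonneg _) zero_le_one, ← Complex.normSq_eq_norm_sq,
          Complex.normSq_mk]
        linarith⟩, rfl⟩
    refine ⟨w, Or.inr (ContinuousMap.ext fun p =>
      sphereToCircle_injective (Circle.ext ?_))⟩
    change _ = (sphereToCircle (circleToSphere (sphereToCircle (rotSphere w p))⁻¹) : ℂ)
    rw [hp, rotSphere_apply, sphereToCircle_circleToSphere, sphereToCircle_circleToSphere,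
      Circle.coe_inv_eq_conj, Circle.coe_mul, coe_sphereToCircle, eucToComplex_apply, hw]
    rw [h] at hd hb
    rw [hd, hb]
    apply Complex.ext <;> simp <;> ring

/-- The loop `γ` precomposed with the rotation by `w`. -/
noncomputable def rotLoop (γ : SphereMaps 1 X) (w : Circle) : SphereMaps 1 X :=
  ⟨γ.1.comp (rotSphere w), γ.2.comp_left _⟩

theorem rotLoop_apply (γ : SphereMaps 1 X) (w : Circle) (p : USphere 1) :
    (rotLoop γ w).1 p = γ.1 (rotSphere w p) := rfl

theorem continuous_rotLoop (γ : SphereMaps 1 X) : Continuous (rotLoop γ) := by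
  refine Continuous.subtype_mk (ContinuousMap.continuous_of_continuous_uncurry _ ?_) _
  change Continuous fun q : Circle × USphere 1 => γ.1 (circleToSphere (q.1 * sphereToCircle q.2))
  fun_prop

/-- The orbit of a loop under rotations. -/
noncomputable def rotOrbit (γ : SphereMaps 1 X) : Set (SphereMaps 1 X) := range (rotLoop γ)

theorem isClosed_rotOrbit [T2Space X] (γ : SphereMaps 1 X) : IsClosed (rotOrbit γ) :=
  (isCompact_range (continuous_rotLoop γ)).isClosed

theorem rotLoop_rotLoop (γ : SphereMaps 1 X) (w z : Circle) :
    rotLoop (rotLoop γ w) z = rotLoop γ (w * z) :=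
  Subtype.ext (ContinuousMap.ext fun p => congrArg γ.1 (rotSphere_rotSphere w z p))

theorem rotOrbit_rotLoop (γ : SphereMaps 1 X) (w : Circle) :
    rotOrbit (rotLoop γ w) = rotOrbit γ := by
  apply Subset.antisymm
  · rintro _ ⟨z, rfl⟩
    exact ⟨w * z, (rotLoop_rotLoop γ w z).symm⟩
  · rintro _ ⟨z, rfl⟩
    exact ⟨w⁻¹ * z, by rw [rotLoop_rotLoop, mul_inv_cancel_left]⟩

theorem disjoint_rotOrbit {γ δ : SphereMaps 1 X} (h : rotOrbit γ ≠ rotOrbit δ) :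
    Disjoint (rotOrbit γ) (rotOrbit δ) := by
  rw [disjoint_left]
  rintro _ ⟨w, rfl⟩ ⟨z, hz⟩
  exact h (by rw [← rotOrbit_rotLoop γ w, ← hz, rotOrbit_rotLoop])

theorem disjoint_constMaps_rotOrbit {γ : SphereMaps 1 X} (h : γ ∉ constMaps 1 X) :
    Disjoint (constMaps 1 X) (rotOrbit γ) := by
  rw [disjoint_right]
  rintro _ ⟨w, rfl⟩ ⟨x, hx⟩
  refine h ⟨x, fun p => ?_⟩
  rw [← hx (rotSphere w⁻¹ p), rotLoop_apply, rotSphere_rotSphere, mul_inv_cancel, rotSphere_one]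

/-- The loop `γ` precomposed with the complex conjugation. -/
noncomputable def conjLoop (γ : SphereMaps 1 X) : SphereMaps 1 X :=
  ⟨γ.1.comp conjSphere, γ.2.comp_left _⟩

theorem conjLoop_notMem_constMaps {γ : SphereMaps 1 X} (h : γ ∉ constMaps 1 X) :
    conjLoop γ ∉ constMaps 1 X := by
  rintro ⟨x, hx⟩
  refine h ⟨x, fun p => ?_⟩
  rw [← hx (conjSphere p)]
  change _ = γ.1 (circleToSphere (sphereToCircle (circleToSphere (sphereToCircle p)⁻¹))⁻¹)
  rw [sphereToCircle_circleToSphere, inv_inv, circleToSphere_sphereToCircle]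

theorem smul_mem_rotOrbit_union (g : OrthGroup 1) (γ : SphereMaps 1 X) :
    g • γ ∈ rotOrbit γ ∪ rotOrbit (conjLoop γ) := by
  obtain ⟨w, h | h⟩ := exists_orthOnSphere_eq g⁻¹
  · exact Or.inl ⟨w, Subtype.ext (congrArg γ.1.comp h.symm)⟩
  · exact Or.inr ⟨w, Subtype.ext (congrArg γ.1.comp h.symm)⟩

/-- If `π₁(X)` is torsion-free, the restriction map has a section over each orbit of the rotation
group. -/
theorem fillable_rotOrbit [T2Space X] (hpi : HasTorsionFreePi1 X) (γ : SphereMaps 1 X) :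
    Fillable (rotOrbit γ) := by
  obtain ⟨m, u, hu, hm⟩ := exists_disc_of_nullhomotopic hpi (γ.2.comp_left circleToSphere)
  let e : C(Circle × UBall 1, ComplexDisc) :=
    { toFun := fun q => ⟨((q.1 : ℂ) * eucToComplex q.2.1) ^ m, by
        rw [mem_closedBall_zero_iff, norm_pow, norm_mul, Circle.norm_coe, one_mul,
          LinearIsometryEquiv.norm_map]
        exact pow_le_one₀ (norm_nonneg _) (mem_closedBall_zero_iff.1 q.2.2)⟩
      continuous_toFun := by
        refine Continuous.subtype_mk (Continuous.pow (Continuous.mul (by fun_prop) ?_) m) _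
        exact eucToComplex.continuous.comp (by fun_prop) }
  let Φ : C(Circle, BallMaps 1 X) := (u.comp e).curry
  let q : C(Circle, rotOrbit γ) :=
    ⟨rangeFactorization (rotLoop γ), (continuous_rotLoop γ).subtype_mk _⟩
  have hqs : Function.Surjective q := rangeFactorization_surjective
  have hq : IsQuotientMap q := q.continuous.isClosedMap.isQuotientMap q.continuous hqs
  have hfac : Function.FactorsThrough Φ q := fun w z h => by
    have h : rotLoop γ w = rotLoop γ z := congrArg Subtype.val h
    -- Rotations giving the same loop differ by a symmetry of `γ`; the filling depends only on `w ^
    -- m`, so it descends to the orbit.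
    have hpow : (w * z⁻¹) ^ m = 1 := hm _ fun y => by
      have := DFunLike.congr_fun (congrArg Subtype.val h) (circleToSphere (z⁻¹ * y))
      rw [rotLoop_apply, rotLoop_apply, rotSphere_apply, rotSphere_apply,
        sphereToCircle_circleToSphere, mul_inv_cancel_left, ← mul_assoc] at this
      exact this
    rw [mul_pow, inv_pow, mul_inv_eq_one] at hpow
    have hpow' : (w : ℂ) ^ m = (z : ℂ) ^ m := by exact_mod_cast congrArg Circle.coeHom hpow
    refine ContinuousMap.ext fun p => congrArg u (Subtype.ext ?_)
    change ((w : ℂ) * eucToComplex p.1) ^ m = ((z : ℂ) * eucToComplex p.1) ^ m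
    rw [mul_pow, mul_pow, hpow']
  refine ⟨hq.lift (f := q) Φ hfac, fun b => (restrictToSphere_eq_iff _ _).2 fun p => ?_⟩
  obtain ⟨w, rfl⟩ := hqs b
  have hl : hq.lift (f := q) Φ hfac (q w) = Φ w :=
    DFunLike.congr_fun (hq.lift_comp (f := q) Φ hfac) w
  rw [hl]
  have he : e (w, sphereIncl 1 p) = circleIncl ((w * sphereToCircle p) ^ m) :=
    Subtype.ext (by push_cast [e, circleIncl]; rfl)
  change u (e (w, sphereIncl 1 p)) = _
  rw [he, hu]
  rfl

theorem fillable_constMaps_union [T2Space X] (hpi : HasTorsionFreePi1 X)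
    {S : Set (SphereMaps 1 X)} (hS : S.Finite) (hSc : ∀ γ ∈ S, γ ∉ constMaps 1 X) :
    Fillable (constMaps 1 X ∪ ⋃ γ ∈ S, rotOrbit γ) := by
  classical
  have hU : (⋃ O ∈ hS.toFinset.image rotOrbit, O) = ⋃ γ ∈ S, rotOrbit γ := by
    rw [Finset.set_biUnion_finset_image]
    simp only [hS.mem_toFinset]
  have hex : ∀ O ∈ hS.toFinset.image rotOrbit, ∃ γ, rotOrbit γ = O := fun O hO => by
    obtain ⟨γ, -, rfl⟩ := Finset.mem_image.1 hO
    exact ⟨γ, rfl⟩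
  refine fillable_constMaps.union_of_disjoint (hU ▸ Fillable.biUnion_finset _ ?_ ?_ ?_)
    isClosed_constMaps (hS.isClosed_biUnion fun γ _ => isClosed_rotOrbit γ) ?_
  · intro O hO
    obtain ⟨γ, rfl⟩ := hex O hO
    exact fillable_rotOrbit hpi γ
  · intro O hO
    obtain ⟨γ, rfl⟩ := hex O hO
    exact isClosed_rotOrbit γ
  · intro O hO P hP
    obtain ⟨γ, rfl⟩ := hex O hO
    obtain ⟨δ, rfl⟩ := hex P hP
    exact disjoint_rotOrbit
  · rw [disjoint_iUnion₂_right]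
    exact fun γ hγ => disjoint_constMaps_rotOrbit (hSc γ hγ)

theorem isClosed_constMaps_union [T2Space X] {S : Set (SphereMaps 1 X)} (hS : S.Finite) :
    IsClosed (constMaps 1 X ∪ ⋃ γ ∈ S, rotOrbit γ) :=
  isClosed_constMaps.union (hS.isClosed_biUnion fun γ _ => isClosed_rotOrbit γ)

end Rotations

/-! ### From critical values to orbits of fixed points -/

section CriticalSet

variable {X : Type u} [TopologicalSpace X] {A : Set (SphereMaps 1 X)} {F : C(A, ℝ)} {φ : C(A, A)}

/-- The complexity of a sublevel set is at most one more than the number of orbits of non-constant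
fixed points in it. -/
theorem ComplexityMonotone.SC_sublevel_le_numNonconstOrbits [Nonempty X]
    (hX : IsMetrizableANR X) (hpi : HasTorsionFreePi1 X) {G : Subgroup (OrthGroup 1)}
    (hcA : constMaps 1 X ⊆ A) (hadm : Admissible G A F φ) (hbdd : BddBelow (range F))
    (hφ : ComplexityMonotone φ) (lam : ℝ) :
    SC 1 X (sublevel F lam) ≤ numNonconstOrbits G (fixSet φ ∩ sublevel F lam) + 1 := by
  have := hX.1
  set 𝒪 : Set (Set (SphereMaps 1 X)) := {O | ∃ γ ∈ fixSet φ ∩ sublevel F lam,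
    γ ∉ constMaps 1 X ∧ O = MulAction.orbit G γ} with h𝒪
  change _ ≤ 𝒪.encard + 1
  rcases 𝒪.finite_or_infinite with hfin | hinf
  swap
  · rw [hinf.encard_eq, top_add]; exact le_top
  have := hfin.to_subtype
  choose rep hrep hrepc hrepO using fun O : 𝒪 => O.2
  have hmemO : ∀ y : A, F y ≤ lam → φ y = y → y.1 ∉ constMaps 1 X →
      ∃ O : 𝒪, ∃ g : G, g.1 • rep O = y.1 := fun y h1 h2 h3 => by
    let O : 𝒪 := ⟨MulAction.orbit G y.1, y.1, ⟨⟨y, h2, rfl⟩, ⟨y, h1, rfl⟩⟩, h3, rfl⟩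
    have : y.1 ∈ O.1 := MulAction.mem_orbit_self _
    rw [hrepO O] at this
    obtain ⟨g, hg⟩ := this
    exact ⟨O, g, hg⟩
  -- An element of `G` may reverse orientation, so each orbit needs the rotation orbits of a
  -- representative and of its conjugate.
  set S : Set (SphereMaps 1 X) := range rep ∪ range fun O => conjLoop (rep O)
  have hS : S.Finite := (finite_range _).union (finite_range _)
  have hSc : ∀ γ ∈ S, γ ∉ constMaps 1 X := by
    rintro _ (⟨O, rfl⟩ | ⟨O, rfl⟩)
    · exact hrepc O
    · exact conjLoop_notMem_constMaps (hrepc O)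
  obtain ⟨W, hW, hKW, hWA⟩ := ((fillable_constMaps_union hpi hS hSc).mono
    inter_subset_left).exists_isOpen hX (A := A) (isClosed_constMaps_union hS)
  refine (hφ.SC_sublevel_le_encard hX hadm.conditionD hbdd hW hWA fun y h1 h2 => hKW ⟨?_, y.2⟩).trans
    ?_
  · by_cases hy : y.1 ∈ constMaps 1 X
    · exact Or.inl hy
    · obtain ⟨O, g, hg⟩ := hmemO y h1 h2 hy
      refine Or.inr (hg ▸ ?_)
      rcases smul_mem_rotOrbit_union g.1 (rep O) with h | h
      · exact mem_biUnion (Or.inl ⟨O, rfl⟩) h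
      · exact mem_biUnion (Or.inr ⟨O, rfl⟩) h
  · obtain ⟨x⟩ := ‹Nonempty X›
    let κ : SphereMaps 1 X := ⟨ContinuousMap.const _ x, ContinuousMap.nullhomotopic_of_constant x⟩
    have hκ : κ ∈ constMaps 1 X := ⟨x, fun _ => rfl⟩
    let val : 𝒪 → ℝ := fun O => F ⟨rep O, sublevel_subset _ (hrep O).2⟩
    -- All constant loops share one value of `F`, the source of the summand `1`; each remaining
    -- orbit contributes at most one more.
    have hsub : F '' Function.fixedPoints φ ∩ Iic lam ⊆ insert (F ⟨κ, hcA hκ⟩) (range val) := by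
      rintro _ ⟨⟨y, h2, rfl⟩, h1⟩
      by_cases hy : y.1 ∈ constMaps 1 X
      · exact Or.inl (hadm.const_on_constMaps _ _ hy hκ)
      · obtain ⟨O, g, hg⟩ := hmemO y h1 h2 hy
        exact Or.inr ⟨O, (hadm.invariant_fun g.1 g.2 _ _ hg.symm).symm⟩
    refine (encard_le_encard hsub).trans ((encard_insert_le _ _).trans (add_le_add_left ?_ 1))
    rw [← image_univ]
    exact (encard_image_le _ _).trans_eq (encard_univ _)

end CriticalSet

/-! ### Deforming `A` into a sublevel set -/

section Deformation

variable {n : ℕ} {X : Type u} [TopologicalSpace X] {A : Set (SphereMaps n X)}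
  {F : C(A, ℝ)} {φ : C(A, A)}

/-- The homotopy from the identity to `φ` moves `B` into `φ '' B`; it need not stay in `B`. -/
theorem complexityMonotone_of_homotopic_id (h : φ.Homotopic (ContinuousMap.id A)) :
    ComplexityMonotone φ := by
  intro B _
  obtain ⟨H⟩ := h.symm
  have hBA : Subtype.val '' B ⊆ A := by
    rintro _ ⟨y, _, rfl⟩
    exact y.2
  refine SC_le_of_homotopy ⟨fun q => (H (q.1, Set.inclusion hBA q.2)).1, ?_⟩
    (fun b => ?_) fun b => ?_
  · exact continuous_subtype_val.comp (H.continuous.comp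
      (continuous_fst.prodMk ((continuous_inclusion hBA).comp continuous_snd)))
  · change (H (0, Set.inclusion hBA b)).1 = b
    rw [H.apply_zero]; rfl
  · change (H (1, Set.inclusion hBA b)).1 ∈ _
    rw [H.apply_one]
    refine mem_image_of_mem _ (mem_image_of_mem _ ?_)
    obtain ⟨_, y, hy, rfl⟩ := b
    exact hy

theorem ConditionD.iterate_le {Y : Type*} [TopologicalSpace Y] {F : C(Y, ℝ)} {φ : C(Y, Y)}
    (hD : ConditionD F φ) (y : Y) {k l : ℕ} (hkl : k ≤ l) : F (φ^[l] y) ≤ F (φ^[k] y) := by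
  induction l, hkl using Nat.le_induction with
  | base => exact le_rfl
  | succ l _ ih =>
    rw [Function.iterate_succ_apply']
    exact (hD.apply_le _).trans ih

/-- Above the critical values, the iterates of every point enter the sublevel set. -/
theorem ConditionD.exists_iterate_lt {Y : Type*} [TopologicalSpace Y] {F : C(Y, ℝ)} {φ : C(Y, Y)}
    (hD : ConditionD F φ) {a : ℝ} (ha : ∀ y, φ y = y → F y < a) (y : Y) :
    ∃ k : ℕ, F (φ^[k] y) < a := by
  by_contra! hcon
  -- If all iterates stayed in the slab between `a` and `F y`, the uniform drop would carry them
  -- below `a`.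
  obtain ⟨ε, hε, H⟩ := hD.exists_uniform_drop_of_Icc a (F y) isOpen_empty
    fun z h1 _ h3 => (not_lt.2 h1 (ha z h3)).elim
  have key : ∀ k : ℕ, F (φ^[k] y) ≤ F y - k * ε := by
    intro k
    induction k with
    | zero => simp
    | succ k ih =>
      rw [Function.iterate_succ_apply']
      refine (H _ (hcon k) (hD.iterate_le y k.zero_le) (notMem_empty _)).trans ?_
      push_cast
      linarith
  obtain ⟨k, hk⟩ := exists_nat_gt ((F y - a) / ε)
  rw [div_lt_iff₀ hε] at hk
  have := (hcon k).trans (key k)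
  linarith

theorem locallyFinite_Icc_natCast :
    LocallyFinite fun k : ℕ => Icc (k : NNReal) (k + 1) := by
  intro r
  refine ⟨Iio (r + 1), Iio_mem_nhds (lt_add_of_pos_right r one_pos),
    (finite_Iic ⌈r + 1⌉₊).subset ?_⟩
  rintro k ⟨s, hs, hsr⟩
  exact_mod_cast (hs.1.trans hsr.le).trans (Nat.le_ceil (r + 1))

/-- The concatenation of the homotopies `φ^k ∘ h`, where `h` is a homotopy from the identity
to `φ`. -/
noncomputable def iterateHomotopy {Y : Type*} [TopologicalSpace Y] {φ : C(Y, Y)}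
    (h : (ContinuousMap.id Y).Homotopy φ) (q : NNReal × Y) : Y :=
  φ^[⌊q.1⌋₊] (h (Set.projIcc 0 1 zero_le_one ((q.1 : ℝ) - ⌊q.1⌋₊), q.2))

theorem continuous_iterateHomotopy {Y : Type*} [TopologicalSpace Y] {φ : C(Y, Y)}
    (h : (ContinuousMap.id Y).Homotopy φ) : Continuous (iterateHomotopy h) := by
  refine (locallyFinite_Icc_natCast.preimage_continuous
    (continuous_fst (X := NNReal) (Y := Y))).continuous ?_
    (fun k => isClosed_Icc.preimage continuous_fst) fun k => ?_
  · refine eq_univ_of_forall fun q => mem_iUnion.2 ⟨⌊q.1⌋₊, Nat.floor_le zero_le, ?_⟩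
    exact (Nat.lt_floor_add_one q.1).le
  · have hc : Continuous fun q : NNReal × Y =>
        φ^[k] (h (Set.projIcc 0 1 zero_le_one ((q.1 : ℝ) - k), q.2)) := by
      refine (φ.continuous.iterate k).comp (h.continuous.comp ?_)
      exact (continuous_projIcc.comp (by fun_prop)).prodMk continuous_snd
    refine hc.continuousOn.congr fun q hq => ?_
    rcases hq.2.lt_or_eq with hlt | heq
    · have : ⌊q.1⌋₊ = k := Nat.floor_eq_on_Ico k q.1 ⟨hq.1, hlt⟩
      rw [iterateHomotopy, this]
    -- At the right endpoint the floor jumps, but the formulas for `k` and `k + 1` agree because `h`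
    -- ends at `φ`.
    · have hfl : ⌊q.1⌋₊ = k + 1 := by
        rw [heq]
        exact_mod_cast Nat.floor_natCast (R := NNReal) (k + 1)
      have h0 : ((q.1 : ℝ) - (k + 1 : ℕ)) = 0 := by rw [heq]; push_cast; ring
      have h1 : ((q.1 : ℝ) - k) = 1 := by rw [heq]; push_cast; ring
      simp only [iterateHomotopy, hfl, h0, h1, projIcc_left, projIcc_right]
      change φ^[k + 1] (h (0, q.2)) = φ^[k] (h (1, q.2))
      rw [h.apply_zero, h.apply_one]
      rfl

/-- If `φ` is homotopic to the identity, then `A` deforms in itself into any sublevel set above the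
critical values. -/
theorem SC_le_sublevel_of_homotopic_id (hX : IsMetrizableANR X)
    (h : φ.Homotopic (ContinuousMap.id A)) (hD : ConditionD F φ) {a : ℝ}
    (ha : ∀ y, φ y = y → F y < a) : SC n X A ≤ SC n X (sublevel F a) := by
  have := hX.metrizableSpace_sphereMaps (n := n)
  let := TopologicalSpace.metrizableSpaceMetric A
  obtain ⟨H⟩ := h.symm
  -- The whole track of `x` is required below `a`, because the fractional part of the stopping time
  -- is not controlled.
  let V : ℕ → Set A := fun k => {x | ∀ t : unitInterval, F (φ^[k] (H (t, x))) < a}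
  have hVo : ∀ k, IsOpen (V k) := fun k => by
    have hc : Continuous fun q : A × unitInterval => F (φ^[k] (H (q.2, q.1))) :=
      F.continuous.comp ((φ.continuous.iterate k).comp (by fun_prop))
    rw [isOpen_iff_mem_nhds]
    intro x hx
    have := isCompact_univ.eventually_forall_of_forall_eventually (x₀ := x)
      (K := (univ : Set unitInterval)) (P := fun x t => F (φ^[k] (H (t, x))) < a)
      (fun t _ => hc.continuousAt.eventually_lt continuousAt_const (hx t))
    filter_upwards [this] with y hy t using hy t (mem_univ t)
  have hVm : Monotone V := fun k l hkl x hx t => (hD.iterate_le _ hkl).trans_lt (hx t)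
  have hVex : ∀ x, ∃ k, x ∈ V k := fun x => by
    have hc : ∀ k, Continuous fun t : unitInterval => F (φ^[k] (H (t, x))) := fun k =>
      F.continuous.comp ((φ.continuous.iterate k).comp (by fun_prop))
    obtain ⟨k, hk⟩ := isCompact_univ.elim_directed_cover
      (fun k => {t : unitInterval | F (φ^[k] (H (t, x))) < a})
      (fun k => isOpen_lt (hc k) continuous_const)
      (fun t _ => mem_iUnion.2 (hD.exists_iterate_lt ha (H (t, x))))
      (directed_of_isDirected_le fun k l hkl t ht => (hD.iterate_le _ hkl).trans_lt ht)
    exact ⟨k, fun t => hk (mem_univ t)⟩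
  -- Admissible times form an upward closed, hence convex, set and are locally constant in `x`, so a
  -- partition of unity yields a continuous choice.
  obtain ⟨τ, hτ⟩ := exists_continuous_forall_mem_convex_of_local_const
    (t := fun x : A => {c : ℝ | 0 ≤ c ∧ x ∈ V ⌊c⌋₊})
    (fun x => OrdConnected.convex ⟨fun c hc d _ e he =>
      ⟨hc.1.trans he.1, hVm (Nat.floor_mono he.1) hc.2⟩⟩)
    (fun x => by
      obtain ⟨k, hk⟩ := hVex x
      refine ⟨k, ?_⟩
      filter_upwards [(hVo k).mem_nhds hk] with y hy
      exact ⟨Nat.cast_nonneg k, by rwa [Nat.floor_natCast]⟩)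
  let T : A → NNReal := fun x => ⟨τ x, (hτ x).1⟩
  have hT : Continuous T := τ.continuous.subtype_mk _
  refine SC_le_of_homotopy
    ⟨fun q => (iterateHomotopy H (unitInterval.toNNReal q.1 * T q.2, q.2)).1, ?_⟩
    (fun x => ?_) fun x => ?_
  · exact continuous_subtype_val.comp ((continuous_iterateHomotopy H).comp (by fun_prop))
  · change (iterateHomotopy H (unitInterval.toNNReal 0 * T x, x)).1 = x
    have h0 : unitInterval.toNNReal 0 * T x = 0 := by simp
    rw [h0]
    simp [iterateHomotopy]
  · change (iterateHomotopy H (unitInterval.toNNReal 1 * T x, x)).1 ∈ sublevel F a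
    have h1 : unitInterval.toNNReal 1 * T x = T x := by simp
    rw [h1]
    exact mem_image_of_mem _ ((hτ x).2 _).le

end Deformation

/-- The `1` stands on the right, which avoids truncated subtraction in `ℕ∞`. Part b) is the bound of
a) at a level above all critical values. -/
theorem mainTheorem3 {X : Type*} [TopologicalSpace X] [PathConnectedSpace X]
    (hX : IsMetrizableANR X) (hpi : HasTorsionFreePi1 X)
    (G : Subgroup (OrthGroup 1)) (hG : IsClosed (G : Set (OrthGroup 1)))
    (A : Set (SphereMaps 1 X)) (hGA : IsInvariantSet G A) (hcA : constMaps 1 X ⊆ A)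
    (F : C(A, ℝ)) (φ : C(A, A)) (hφ : IsHomotopyEquiv φ)
    (hadm : Admissible G A F φ) (hbdd : BddBelow (Set.range F)) :
    (ComplexityMonotone φ → ∀ lam : ℝ,
      SC 1 X (sublevel F lam) ≤ numNonconstOrbits G (fixSet φ ∩ sublevel F lam) + 1) ∧
    (φ.Homotopic (ContinuousMap.id A) → (F '' Function.fixedPoints φ).Finite →
      SC 1 X A ≤ numNonconstOrbits G (fixSet φ) + 1) := by
  have hne : Nonempty X := PathConnectedSpace.nonempty
  refine ⟨fun hmono => hmono.SC_sublevel_le_numNonconstOrbits hX hpi hcA hadm hbdd,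
    fun hid hfin => ?_⟩
  obtain ⟨a, ha⟩ := hfin.bddAbove
  have hlt : ∀ y, φ y = y → F y < a + 1 := fun y hy =>
    (ha (mem_image_of_mem F hy)).trans_lt (lt_add_one a)
  refine (SC_le_sublevel_of_homotopic_id hX hid hadm.conditionD hlt).trans
    (((complexityMonotone_of_homotopic_id hid).SC_sublevel_le_numNonconstOrbits hX hpi hcA hadm
      hbdd (a + 1)).trans (add_le_add_left (encard_le_encard ?_) 1))
  rintro O ⟨γ, hγ, hc, rfl⟩
  exact ⟨γ, hγ.1, hc, rfl⟩
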